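/- Let $ABC$ be a nondegenerate triangle in the Euclidean plane. For a triangle $ABC$, the external Morley triangle opposite $A$ is the triangle $A_AB_AC_A$ obtained from the trisectors of the interior angle at $A$ and of two exterior angles: the one at $B$ between $BC$ and the extension of $AB$ beyond $B$, and the one at $C$ between $CB$ and the extension of $AC$ beyond $C$. Namely, * $A_A$ is the intersection of the trisector of this exterior angle at $B$ nearer to $BC$ and the trisector of this exterior angle at $C$ nearer to $CB$; * $B_A$ is the intersection of the trisector of the interior angle at $A$ nearer to $AB$ and the trisector of this exterior angle at $B$ nearer to the extension of $AB$; * $C_A$ is the intersection of the trisector of the interior angle at $A$ nearer to $AC$ and the trisector of this exterior angle at $C$ nearer to the extension of $AC$. Define the external Morley triangles $B_BC_BA_B$ (opposite $B$) and $C_CA_CB_C$ (opposite $C$) in the same way, by cyclic permutation of $A,B,C$: thus $B_B$, $C_B$, $A_B$ are the vertices adjacent to the lines $CA$, $BC$, $AB$ respectively, and $C_C$, $A_C$, $B_C$ are the vertices adjacent to $AB$, $CA$, $BC$ respectively. These give the three external Morley triangles $A_AB_AC_A$, $A_BB_BC_B$, $A_CB_CC_C$ of $ABC$. Then each of the triples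 $\{A_A,A_B,A_C\}$, $\{B_B,B_C,B_A\}$, $\{C_C,C_A,C_B\}$ and each of the quadruples $\{C_A,B_A,B_B,C_C\}$, $\{A_B,C_B,C_C,A_A\}$, $\{B_C,A_C,A_A,B_B\}$ lies on a unique circle. Let $l_A$ be the radical line (the set of points of equal power) of the circles $(A_AA_BA_C)$ and $(C_AB_AB_BC_C)$, let $l_B$ be the radical line of $(B_BB_CB_A)$ and $(A_BC_BC_CA_A)$, and let $l_C$ be the radical line of $(C_CC_AC_B)$ and $(B_CA_CA_AB_B)$. Then $l_A$, $l_B$, $l_C$ are lines which form a nondegenerate triangle $XYZ$, with $X=l_B\cap l_C$, $Y=l_C\cap l_A$, $Z=l_A\cap l_B$, and this triangle is perspective to $ABC$: $X\neq A$, $Y\neq B$, $Z\neq C$, and the lines $AX$, $BY$, $CZ$ pass through a common point. -/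

import Mathlib

open EuclideanGeometry

/-- The Euclidean plane. -/
abbrev Plane := EuclideanSpace ℝ (Fin 2)

/-- `X` lies on the (open) ray from `V` that trisects the angle `PVQ` and is the one of the two
trisectors nearer to the side `VP`: the angle `PVX` is a third, and the angle `XVQ` two thirds,
of the angle `PVQ`. (For `0 < ∠ P V Q < π` this singles out exactly one ray in the plane.) -/
def OnTrisector (P V Q X : Plane) : Prop :=
  X ≠ V ∧ ∠ P V X = ∠ P V Q / 3 ∧ ∠ X V Q = 2 * ∠ P V Q / 3

/-- `X Y Z` is the external Morley triangle of the triangle `A B C` lying opposite `A`: its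
vertices are the intersections of adjacent trisectors of the interior angle at `A`
and of the exterior angles at `B` (between `BC` and the extension of `AB` beyond `B`) and
at `C` (between `CB` and the extension of `AC` beyond `C`).
`X` belongs to the side `BC`, `Y` to the side `AB`, and `Z` to the side `AC`. -/
structure IsExternalMorleyTriangle (A B C X Y Z : Plane) : Prop where
  /-- `X` is on the trisector of the exterior angle at `B` nearer to `BC`. -/
  fst_B : OnTrisector C B (AffineEquiv.pointReflection ℝ B A) X
  /-- `X` is on the trisector of the exterior angle at `C` nearer to `CB`. -/
  fst_C : OnTrisector B C (AffineEquiv.pointReflection ℝ C A) X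
  /-- `Y` is on the trisector of the interior angle at `A` nearer to `AB`. -/
  snd_A : OnTrisector B A C Y
  /-- `Y` is on the trisector of the exterior angle at `B` nearer to the line `AB`. -/
  snd_B : OnTrisector (AffineEquiv.pointReflection ℝ B A) B C Y
  /-- `Z` is on the trisector of the interior angle at `A` nearer to `AC`. -/
  trd_A : OnTrisector C A B Z
  /-- `Z` is on the trisector of the exterior angle at `C` nearer to the line `AC`. -/
  trd_C : OnTrisector (AffineEquiv.pointReflection ℝ C A) C B Z

/-- `ω` is the circle through the points of `s`: it contains `s` and is the only circle to do so. -/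
def IsCircleThrough (ω : Sphere Plane) (s : Set Plane) : Prop :=
  s ⊆ (ω : Set Plane) ∧ ∀ ω' : Sphere Plane, s ⊆ (ω' : Set Plane) → ω' = ω

/-- The radical line of two circles: the points of equal power with respect to both. -/
def radicalLine (ω₁ ω₂ : Sphere Plane) : Set Plane :=
  {P | ω₁.power P = ω₂.power P}

/-- The circle through the points of `s` and the circle through the points of `t` both exist,
and `l` is a straight line, namely their radical line. -/
def IsRadicalLineOf (l : AffineSubspace ℝ Plane) (s t : Set Plane) : Prop :=
  Module.finrank ℝ l.direction = 1 ∧ ∃ ω₁ ω₂ : Sphere Plane,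
    IsCircleThrough ω₁ s ∧ IsCircleThrough ω₂ t ∧ (l : Set Plane) = radicalLine ω₁ ω₂

/-- The three lines `l₁, l₂, l₃` form the (nondegenerate) triangle `X Y Z`, where `l₁, l₂, l₃`
are the side lines opposite `X, Y, Z`. -/
def FormTriangle (l₁ l₂ l₃ : AffineSubspace ℝ Plane) (X Y Z : Plane) : Prop :=
  AffineIndependent ℝ ![X, Y, Z] ∧ l₁ = line[ℝ, Y, Z] ∧ l₂ = line[ℝ, Z, X] ∧ l₃ = line[ℝ, X, Y]

/-- The triangles `A B C` and `X Y Z` are perspective: the lines `AX, BY, CZ` are concurrent. -/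
def ArePerspective (A B C X Y Z : Plane) : Prop :=
  A ≠ X ∧ B ≠ Y ∧ C ≠ Z ∧ ∃ P : Plane, P ∈ line[ℝ, A, X] ∧ P ∈ line[ℝ, B, Y] ∧ P ∈ line[ℝ, C, Z]

/-! ### Directions of trisectors. -/

open scoped RealInnerProductSpace

/-! Write the angles of the triangle as 3α₁, 3α₂, 3α₃, so that the αᵢ sum to π/3, and put uᵢ = 2 sin
αᵢ / √3, vᵢ = 2 sin (π/3 - αᵢ) / √3. Sides, trisector directions and barycentric coordinates of all
Morley vertices become rational in these quantities (`fst_eq`, `snd_eq`, `trd_eq`), and the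
relations among them are polynomial.

A circle is determined by the powers of A, B, C, and its equation in barycentric coordinates is the
linear form with those powers as coefficients minus the quadratic form of the circumcircle
(`power_barycentric`). With the powers guessed in closed form, concyclicity is a polynomial identity
for each vertex. The circle through C_A, B_A, B_B, C_C also passes through A, where its power is 0.
Subtracting two circles cancels the quadratic part, so radical lines are linear equations
(`exists_circles`).

Let σᵢ = (vᵢ - uᵢ)/2 = cos (αᵢ + π/3), and let G be the symmetric matrix with diagonal 1 and
off-diagonal entries σ₃, σ₂, σ₁ in positions 12, 13, 23. In trilinear coordinates the three radical
lines are the rows of the adjugate of G, hence X, Y, Z are the rows of G: X = (1 : σ₃ : σ₂), and so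
on. Thus AX, BY, CZ meet at (σ₂σ₃ : σ₃σ₁ : σ₁σ₂), and XYZ is nondegenerate since det G > 0
(`gram_pos`). What remains is that no point is at infinity, i.e. that the normalizing sums are
nonzero (`sum_vertex_pos`, `sum_perspector_pos`). -/

/-- The direction of the trisector of the angle between `p` and `q` nearer to `p`. -/
theorem eq_smul_of_angle_trisector {E : Type*} [NormedAddCommGroup E] [InnerProductSpace ℝ E]
    {p q x : E} {t : ℝ} (hp : p ≠ 0) (hq : q ≠ 0)
    (hpq : InnerProductGeometry.angle p q = 3 * t)
    (hpx : InnerProductGeometry.angle p x = t) (hxq : InnerProductGeometry.angle x q = 2 * t)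
    (ht0 : 0 ≤ t) (ht : 3 * t < Real.pi) :
    ∃ r : ℝ, x = r • ((2 * Real.cos t / ‖p‖) • p + (1 / ‖q‖) • q) := by
  have hc : 1 / 2 < Real.cos t := by
    rw [← Real.cos_pi_div_three]
    exact Real.cos_lt_cos_of_nonneg_of_le_pi ht0 (by linarith [Real.pi_pos]) (by linarith)
  set c := Real.cos t with hcdef
  have hk : 4 * c ^ 2 - 1 ≠ 0 := by nlinarith
  have hpn : ‖p‖ ≠ 0 := norm_ne_zero_iff.mpr hp
  have hqn : ‖q‖ ≠ 0 := norm_ne_zero_iff.mpr hq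
  have h1 : ⟪p, x⟫ = c * (‖p‖ * ‖x‖) := by
    rw [← InnerProductGeometry.cos_angle_mul_norm_mul_norm, hpx]
  have h2 : ⟪x, q⟫ = (2 * c ^ 2 - 1) * (‖x‖ * ‖q‖) := by
    rw [← InnerProductGeometry.cos_angle_mul_norm_mul_norm, hxq, Real.cos_two_mul]
  have h3 : ⟪p, q⟫ = (4 * c ^ 3 - 3 * c) * (‖p‖ * ‖q‖) := by
    rw [← InnerProductGeometry.cos_angle_mul_norm_mul_norm, hpq, Real.cos_three_mul]
  -- The vector 2c·p/‖p‖ + q/‖q‖ has norm 4c² - 1, which is positive because c > 1/2. All inner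
  -- products are known, so the difference is shown to have squared norm zero; no assumption of
  -- coplanarity is needed.
  refine ⟨‖x‖ / (4 * c ^ 2 - 1), ?_⟩
  rw [← sub_eq_zero, ← inner_self_eq_zero (𝕜 := ℝ)]
  simp only [inner_sub_left, inner_sub_right, inner_add_left, inner_add_right, inner_smul_left,
    inner_smul_right, real_inner_self_eq_norm_sq, real_inner_comm p x, real_inner_comm x q,
    real_inner_comm p q]
  simp only [h1, h2, h3, RCLike.conj_to_real]
  field_simp
  ring

/-! ### Barycentric coordinates and spheres with prescribed powers. -/

/-- The power of a point in barycentric coordinates. -/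
theorem power_barycentric (ω : Sphere Plane) (A B C : Plane) {x y z : ℝ} (h : x + y + z = 1) :
    ω.power (x • A + y • B + z • C) = x * ω.power A + y * ω.power B + z * ω.power C -
      (y * z * dist B C ^ 2 + z * x * dist C A ^ 2 + x * y * dist A B ^ 2) := by
  obtain rfl : x = 1 - y - z := by linarith
  simp only [Sphere.power, EuclideanSpace.dist_eq, Fin.sum_univ_two, Real.dist_eq, sq_abs]
  repeat rw [Real.sq_sqrt (by positivity)]
  simp only [PiLp.add_apply, PiLp.smul_apply, smul_eq_mul]
  ring

theorem affineIndependent_iff_linearIndependent_sub {A B C : Plane} :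
    AffineIndependent ℝ ![A, B, C] ↔ LinearIndependent ℝ ![B - A, C - A] := by
  rw [affineIndependent_iff_linearIndependent_vsub ℝ _ (0 : Fin 3),
    ← linearIndependent_equiv (finSuccAboveEquiv (0 : Fin 3))]
  have : (fun i : {x : Fin 3 // x ≠ 0} => (![A, B, C] i -ᵥ ![A, B, C] 0 : Plane)) ∘
      finSuccAboveEquiv (0 : Fin 3) = ![B - A, C - A] := by
    funext i
    fin_cases i <;> rfl
  rw [this]

theorem eq_zero_of_smul_add_smul_sub {A B C : Plane} (h : AffineIndependent ℝ ![A, B, C])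
    {s t : ℝ} (hst : s • (B - A) + t • (C - A) = 0) : s = 0 ∧ t = 0 := by
  exact LinearIndependent.pair_iff.mp (affineIndependent_iff_linearIndependent_sub.mp h) s t hst

theorem det_ne_zero_of_affineIndependent {A B C : Plane} (h : AffineIndependent ℝ ![A, B, C]) :
    (B 0 - A 0) * (C 1 - A 1) - (B 1 - A 1) * (C 0 - A 0) ≠ 0 := by
  intro hd
  have h0 := eq_zero_of_smul_add_smul_sub h (s := C 0 - A 0) (t := -(B 0 - A 0)) (by
    ext i; fin_cases i
    · simp; ring
    · simp; linear_combination -hd)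
  have h1 := eq_zero_of_smul_add_smul_sub h (s := C 1 - A 1) (t := -(B 1 - A 1)) (by
    ext i; fin_cases i
    · simp; linear_combination hd
    · simp; ring)
  have h2 := eq_zero_of_smul_add_smul_sub h (s := 1) (t := 0) (by
    ext i; fin_cases i
    · simp; linarith [h0.2]
    · simp; linarith [h1.2])
  exact one_ne_zero h2.1

theorem eq_zero_of_barycentric_eq_zero {A B C : Plane} (h : AffineIndependent ℝ ![A, B, C])
    {x y z : ℝ} (hs : x + y + z = 0) (h0 : x • A + y • B + z • C = 0) :
    x = 0 ∧ y = 0 ∧ z = 0 := by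
  obtain rfl : x = - y - z := by linarith
  have := eq_zero_of_smul_add_smul_sub h (s := y) (t := z) (by rw [← h0]; module)
  simp [this]

theorem exists_barycentric {A B C : Plane} (h : AffineIndependent ℝ ![A, B, C]) (P : Plane) :
    ∃ x y z : ℝ, x + y + z = 1 ∧ P = x • A + y • B + z • C := by
  have hd := det_ne_zero_of_affineIndependent h
  set d := (B 0 - A 0) * (C 1 - A 1) - (B 1 - A 1) * (C 0 - A 0) with hdd
  -- Cramer's rule for P - A in the basis B - A, C - A.
  set y := ((P 0 - A 0) * (C 1 - A 1) - (P 1 - A 1) * (C 0 - A 0)) / d with hy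
  set z := ((B 0 - A 0) * (P 1 - A 1) - (B 1 - A 1) * (P 0 - A 0)) / d with hz
  refine ⟨1 - y - z, y, z, by ring, ?_⟩
  have hy' : y * d = (P 0 - A 0) * (C 1 - A 1) - (P 1 - A 1) * (C 0 - A 0) := by
    rw [hy]; field_simp
  have hz' : z * d = (B 0 - A 0) * (P 1 - A 1) - (B 1 - A 1) * (P 0 - A 0) := by
    rw [hz]; field_simp
  clear_value y z
  ext i; fin_cases i <;> apply mul_right_cancel₀ hd <;>
    simp only [PiLp.add_apply, PiLp.smul_apply, smul_eq_mul, Fin.zero_eta, Fin.mk_one]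
  · linear_combination (norm := (rw [hdd]; ring)) -(B 0 - A 0) * hy' - (C 0 - A 0) * hz'
  · linear_combination (norm := (rw [hdd]; ring)) -(B 1 - A 1) * hy' - (C 1 - A 1) * hz'

/-- A triangle whose vertices have independent barycentric coordinates is nondegenerate. -/
theorem affineIndependent_of_barycentric {A B C : Plane}
    (h : AffineIndependent ℝ ![A, B, C]) {x₁ y₁ z₁ x₂ y₂ z₂ x₃ y₃ z₃ : ℝ}
    (h₁ : x₁ + y₁ + z₁ = 1) (h₂ : x₂ + y₂ + z₂ = 1) (h₃ : x₃ + y₃ + z₃ = 1)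
    (hd : x₁ * (y₂ * z₃ - z₂ * y₃) + y₁ * (z₂ * x₃ - x₂ * z₃) + z₁ * (x₂ * y₃ - y₂ * x₃) ≠ 0) :
    AffineIndependent ℝ ![x₁ • A + y₁ • B + z₁ • C, x₂ • A + y₂ • B + z₂ • C,
      x₃ • A + y₃ • B + z₃ • C] := by
  rw [affineIndependent_iff_linearIndependent_sub, LinearIndependent.pair_iff]
  intro s t hst
  obtain ⟨hx, hy, hz⟩ := eq_zero_of_barycentric_eq_zero h
    (x := s * (x₂ - x₁) + t * (x₃ - x₁)) (y := s * (y₂ - y₁) + t * (y₃ - y₁))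
    (z := s * (z₂ - z₁) + t * (z₃ - z₁))
    (by linear_combination s * (h₂ - h₁) + t * (h₃ - h₁)) (by rw [← hst]; module)
  constructor <;> apply mul_right_cancel₀ hd
  · linear_combination (y₃ * z₁ - z₃ * y₁) * hx + (z₃ * x₁ - x₃ * z₁) * hy
      + (x₃ * y₁ - y₃ * x₁) * hz
  · linear_combination (y₁ * z₂ - z₁ * y₂) * hx + (z₁ * x₂ - x₁ * z₂) * hy
      + (x₁ * y₂ - y₁ * x₂) * hz

/-- A sphere through a given point whose powers at the vertices of a triangle are prescribed. -/
theorem exists_sphere_power_eq {A B C : Plane} (h : AffineIndependent ℝ ![A, B, C])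
    (u v w : ℝ) {x y z : ℝ} (hs : x + y + z = 1)
    (h0 : x * u + y * v + z * w =
      y * z * dist B C ^ 2 + z * x * dist C A ^ 2 + x * y * dist A B ^ 2) :
    ∃ ω : Sphere Plane, 0 ≤ ω.radius ∧ ω.power A = u ∧ ω.power B = v ∧ ω.power C = w := by
  have hd := det_ne_zero_of_affineIndependent h
  set d := (B 0 - A 0) * (C 1 - A 1) - (B 1 - A 1) * (C 0 - A 0) with hdd
  set p := (A 0 ^ 2 + A 1 ^ 2 - B 0 ^ 2 - B 1 ^ 2 - u + v) / 2 with hp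
  set q := (A 0 ^ 2 + A 1 ^ 2 - C 0 ^ 2 - C 1 ^ 2 - u + w) / 2 with hq
  -- Differences of powers depend only on the centre and are affine in it, so the centre solves a
  -- 2×2 linear system.
  set O0 := (-p * (C 1 - A 1) + q * (B 1 - A 1)) / d with hO0
  set O1 := (-q * (B 0 - A 0) + p * (C 0 - A 0)) / d with hO1
  have h1 : O0 * d = -p * (C 1 - A 1) + q * (B 1 - A 1) := by rw [hO0]; field_simp
  have h2 : O1 * d = -q * (B 0 - A 0) + p * (C 0 - A 0) := by rw [hO1]; field_simp
  clear_value O0 O1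
  have e1 : O0 * (B 0 - A 0) + O1 * (B 1 - A 1) = -p := by
    apply mul_right_cancel₀ hd
    linear_combination (norm := (rw [hdd]; ring)) (B 0 - A 0) * h1 + (B 1 - A 1) * h2
  have e2 : O0 * (C 0 - A 0) + O1 * (C 1 - A 1) = -q := by
    apply mul_right_cancel₀ hd
    linear_combination (norm := (rw [hdd]; ring)) (C 0 - A 0) * h1 + (C 1 - A 1) * h2
  let O : Plane := !₂[O0, O1]
  -- Passing through an actual point makes the radius real; `h0` then fixes the remaining additive
  -- constant in the powers.
  let ω : Sphere Plane := ⟨O, dist (x • A + y • B + z • C) O⟩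
  have hAB : ω.power A - ω.power B = u - v := by
    simp only [Sphere.power, EuclideanSpace.dist_eq, Fin.sum_univ_two, Real.dist_eq, sq_abs, ω]
    repeat rw [Real.sq_sqrt (by positivity)]
    simp only [O, Matrix.cons_val_zero, Matrix.cons_val_one]
    linear_combination 2 * e1 + 2 * hp
  have hAC : ω.power A - ω.power C = u - w := by
    simp only [Sphere.power, EuclideanSpace.dist_eq, Fin.sum_univ_two, Real.dist_eq, sq_abs, ω]
    repeat rw [Real.sq_sqrt (by positivity)]
    simp only [O, Matrix.cons_val_zero, Matrix.cons_val_one]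
    linear_combination 2 * e2 + 2 * hq
  have h3 := power_barycentric ω A B C hs
  have h4 : ω.power (x • A + y • B + z • C) = 0 := by simp [ω, Sphere.power]
  have hA : ω.power A = u := by
    linear_combination -h3 + h4 - h0 + y * hAB + z * hAC - (ω.power A - u) * hs
  exact ⟨ω, dist_nonneg, hA, by linarith, by linarith⟩

/-- Two distinct circles in a plane share at most two points. -/
theorem isCircleThrough_of_three {ω : Sphere Plane} {s : Set Plane} (hs : s ⊆ ω) {P Q R : Plane}
    (hP : P ∈ s) (hQ : Q ∈ s) (hR : R ∈ s) (hPQ : P ≠ Q) (hPR : P ≠ R) (hQR : Q ≠ R) :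
    IsCircleThrough ω s := by
  refine ⟨hs, fun ω' hs' => ?_⟩
  by_contra hne
  have : Fact (Module.finrank ℝ Plane = 2) := ⟨by simp⟩
  rcases eq_of_mem_sphere_of_mem_sphere_of_finrank_eq_two (by simp) hne hPQ
    (hs' hP) (hs' hQ) (hs' hR) (hs hP) (hs hQ) (hs hR) with h | h
  · exact hPR h.symm
  · exact hQR h.symm

/-! ### Algebraic relations between the third-angle quantities. -/

/-- The trigonometry of a nondegenerate triangle `A B C` with angles `3 α₁, 3 α₂, 3 α₃`:
`uᵢ = 2 sin αᵢ / √3` and `vᵢ = 2 sin (π / 3 - αᵢ) / √3`. -/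
structure ThirdAngleData (A B C : Plane) (d u₁ v₁ u₂ v₂ u₃ v₃ : ℝ) : Prop where
  indep : AffineIndependent ℝ ![A, B, C]
  d_pos : 0 < d
  u₁_pos : 0 < u₁
  v₁_pos : 0 < v₁
  u₂_pos : 0 < u₂
  v₂_pos : 0 < v₂
  u₃_pos : 0 < u₃
  v₃_pos : 0 < v₃
  norm₁ : u₁ ^ 2 + u₁ * v₁ + v₁ ^ 2 = 1
  norm₂ : u₂ ^ 2 + u₂ * v₂ + v₂ ^ 2 = 1
  norm₃ : u₃ ^ 2 + u₃ * v₃ + v₃ ^ 2 = 1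
  u₁_eq : u₁ = v₂ * v₃ - u₂ * u₃
  u₂_eq : u₂ = v₃ * v₁ - u₃ * u₁
  u₃_eq : u₃ = v₁ * v₂ - u₁ * u₂
  v₁_eq : v₁ = u₂ * v₃ + u₂ * u₃ + v₂ * u₃
  v₂_eq : v₂ = u₃ * v₁ + u₃ * u₁ + v₃ * u₁
  v₃_eq : v₃ = u₁ * v₂ + u₁ * u₂ + v₁ * u₂
  dist_BC : dist B C = d * (u₁ * v₁ * (u₁ + v₁))
  dist_CA : dist C A = d * (u₂ * v₂ * (u₂ + v₂))
  dist_AB : dist A B = d * (u₃ * v₃ * (u₃ + v₃))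
  cos₁ : 2 * Real.cos (∠ B A C / 3) = 2 * v₁ + u₁
  cos₂ : 2 * Real.cos (∠ C B A / 3) = 2 * v₂ + u₂
  cos₃ : 2 * Real.cos (∠ A C B / 3) = 2 * v₃ + u₃
  cos_ext₁ : 2 * Real.cos ((Real.pi - ∠ B A C) / 3) = 2 * u₁ + v₁
  cos_ext₂ : 2 * Real.cos ((Real.pi - ∠ C B A) / 3) = 2 * u₂ + v₂
  cos_ext₃ : 2 * Real.cos ((Real.pi - ∠ A C B) / 3) = 2 * u₃ + v₃

namespace ThirdAngleData

variable {A B C : Plane} {d u₁ v₁ u₂ v₂ u₃ v₃ : ℝ}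

/-- Together with `swap` this makes the data symmetric under all permutations of the vertices, so
computations are done at one vertex only. -/
theorem rotate (h : ThirdAngleData A B C d u₁ v₁ u₂ v₂ u₃ v₃) :
    ThirdAngleData B C A d u₂ v₂ u₃ v₃ u₁ v₁ where
  indep := by
    have := h.indep
    rw [affineIndependent_iff_not_collinear_set] at this ⊢
    rwa [Set.insert_comm A B, Set.pair_comm A C] at this
  d_pos := h.d_pos
  u₁_pos := h.u₂_pos
  v₁_pos := h.v₂_pos
  u₂_pos := h.u₃_pos
  v₂_pos := h.v₃_pos
  u₃_pos := h.u₁_pos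
  v₃_pos := h.v₁_pos
  norm₁ := h.norm₂
  norm₂ := h.norm₃
  norm₃ := h.norm₁
  u₁_eq := h.u₂_eq
  u₂_eq := h.u₃_eq
  u₃_eq := h.u₁_eq
  v₁_eq := h.v₂_eq
  v₂_eq := h.v₃_eq
  v₃_eq := h.v₁_eq
  dist_BC := h.dist_CA
  dist_CA := h.dist_AB
  dist_AB := h.dist_BC
  cos₁ := h.cos₂
  cos₂ := h.cos₃
  cos₃ := h.cos₁
  cos_ext₁ := h.cos_ext₂
  cos_ext₂ := h.cos_ext₃
  cos_ext₃ := h.cos_ext₁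

theorem swap (h : ThirdAngleData A B C d u₁ v₁ u₂ v₂ u₃ v₃) :
    ThirdAngleData A C B d u₁ v₁ u₃ v₃ u₂ v₂ where
  indep := by
    have := h.indep
    rw [affineIndependent_iff_not_collinear_set] at this ⊢
    rwa [Set.pair_comm]
  d_pos := h.d_pos
  u₁_pos := h.u₁_pos
  v₁_pos := h.v₁_pos
  u₂_pos := h.u₃_pos
  v₂_pos := h.v₃_pos
  u₃_pos := h.u₂_pos
  v₃_pos := h.v₂_pos
  norm₁ := h.norm₁
  norm₂ := h.norm₃
  norm₃ := h.norm₂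
  u₁_eq := by linarith [h.u₁_eq]
  u₂_eq := by linarith [h.u₃_eq]
  u₃_eq := by linarith [h.u₂_eq]
  v₁_eq := by linarith [h.v₁_eq]
  v₂_eq := by linarith [h.v₃_eq]
  v₃_eq := by linarith [h.v₂_eq]
  dist_BC := by rw [dist_comm, h.dist_BC]
  dist_CA := by rw [dist_comm, h.dist_AB]
  dist_AB := by rw [dist_comm, h.dist_CA]
  cos₁ := by rw [angle_comm, h.cos₁]
  cos₂ := by rw [angle_comm, h.cos₃]
  cos₃ := by rw [angle_comm, h.cos₂]
  cos_ext₁ := by rw [angle_comm, h.cos_ext₁]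
  cos_ext₂ := by rw [angle_comm, h.cos_ext₃]
  cos_ext₃ := by rw [angle_comm, h.cos_ext₂]

/-- Locates the intersection of the exterior trisectors from B and C. As in all the identities
below, the third angle is eliminated, leaving a polynomial identity modulo the two relations u² + uv
+ v² = 1. -/
theorem identity_fst (h : ThirdAngleData A B C d u₁ v₁ u₂ v₂ u₃ v₃) :
    u₃ * v₃ * (u₃ + v₃) * (2 * u₂ + v₂) + u₂ * v₂ * (u₂ + v₂) * (2 * u₃ + v₃) -
      u₁ * v₁ * (u₁ + v₁) = 3 * u₂ * (u₂ + v₂) * u₃ * (u₃ + v₃) * (u₁ + v₁) := by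
  have e₁ := h.norm₁
  have e₂ := h.norm₂
  rw [h.u₃_eq, h.v₃_eq]
  linear_combination
    (-(u₂ * v₂ * (u₂ + v₂) * (2 * (v₁ * v₂ - u₁ * u₂) + (u₁ * v₂ + u₁ * u₂ + v₁ * u₂)))) * e₁ +
    u₁ * v₁ * (u₁ + v₁) * (1 + (u₂ ^ 2 + u₂ * v₂ + v₂ ^ 2)) * e₂

theorem identity_snd (h : ThirdAngleData A B C d u₁ v₁ u₂ v₂ u₃ v₃) :
    u₂ * v₂ * (u₂ + v₂) * (2 * v₁ + u₁) - u₁ * v₁ * (u₁ + v₁) * (2 * u₂ + v₂) +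
      u₃ * v₃ * (u₃ + v₃) = 3 * u₂ * (u₂ + v₂) * v₁ * (u₁ + v₁) * u₃ := by
  have e₁ := h.norm₁
  have e₂ := h.norm₂
  rw [h.u₃_eq, h.v₃_eq]
  linear_combination
    -(u₂ * v₂ * (u₂ + v₂) * (2 * v₁ + u₁)) * e₁ +
    u₁ * v₁ * (u₁ + v₁) * (2 * u₂ + v₂) * e₂

/-- This and the next three are circle equations at a Morley vertex with the common rational factor
removed. -/
theorem identity_circle_fst_fst (h : ThirdAngleData A B C d u₁ v₁ u₂ v₂ u₃ v₃) :
    (2 * u₃ + v₃) * (2 * u₂ + v₂) * (u₁ * v₁ * (u₁ + v₁)) -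
      (2 * u₂ + v₂) * (u₂ * v₂ * (u₂ + v₂)) - (2 * u₃ + v₃) * (u₃ * v₃ * (u₃ + v₃)) =
    3 * u₂ * (u₂ + v₂) * u₃ * (u₃ + v₃) *
      ((u₁ + v₁) ^ 2 - v₁ * v₂ * (2 * u₃ + v₃) - v₁ * v₃ * (2 * u₂ + v₂)) := by
  have e₁ := h.norm₁
  have e₂ := h.norm₂
  rw [h.u₃_eq, h.v₃_eq]
  linear_combination
    -((2 * (v₁ * v₂ - u₁ * u₂) + (u₁ * v₂ + u₁ * u₂ + v₁ * u₂)) * (2 * u₂ + v₂) *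
      (u₁ * v₁ * (u₁ + v₁))) * (1 + (u₂ ^ 2 + u₂ * v₂ + v₂ ^ 2)) * e₂ +
    (2 * u₂ + v₂) * (u₂ * v₂ * (u₂ + v₂)) * ((u₁ ^ 2 + u₁ * v₁ + v₁ ^ 2) ^ 2 * e₂ +
      (1 + (u₁ ^ 2 + u₁ * v₁ + v₁ ^ 2)) * e₁) +
    (2 * (v₁ * v₂ - u₁ * u₂) + (u₁ * v₂ + u₁ * u₂ + v₁ * u₂)) * ((v₁ * v₂ - u₁ * u₂) *
      (u₁ * v₂ + u₁ * u₂ + v₁ * u₂) * (v₁ * v₂ - u₁ * u₂ + (u₁ * v₂ + u₁ * u₂ + v₁ * u₂))) * e₂ +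
    3 * u₂ * (u₂ + v₂) * (v₁ * v₂ - u₁ * u₂) *
      (v₁ * v₂ - u₁ * u₂ + (u₁ * v₂ + u₁ * u₂ + v₁ * u₂)) * (u₁ + v₁) ^ 2 * e₂

theorem identity_circle_fst_trd (h : ThirdAngleData A B C d u₁ v₁ u₂ v₂ u₃ v₃) :
    (2 * v₂ + u₂) * (u₂ * v₂ * (u₂ + v₂)) - (2 * u₁ + v₁) * (u₁ * v₁ * (u₁ + v₁)) -
      (2 * v₂ + u₂) * (2 * u₁ + v₁) * (u₃ * v₃ * (u₃ + v₃)) =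
    3 * u₁ * v₂ * (u₂ + v₂) * u₃ *
      ((2 * u₁ + v₁) * v₁ * v₂ - (2 * v₂ + u₂) * (u₁ + v₁) ^ 2 - v₁ * v₃) := by
  have e₁ := h.norm₁
  have e₂ := h.norm₂
  rw [h.u₃_eq, h.v₃_eq]
  linear_combination
    (2 * u₁ + v₁) * (u₁ * v₁ * (u₁ + v₁)) * (1 + (u₂ ^ 2 + u₂ * v₂ + v₂ ^ 2)) * e₂ -
    (2 * v₂ + u₂) * (u₂ * v₂ * (u₂ + v₂)) * (1 + (u₁ ^ 2 + u₁ * v₁ + v₁ ^ 2)) * e₁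

theorem identity_circle_snd_snd (h : ThirdAngleData A B C d u₁ v₁ u₂ v₂ u₃ v₃) :
    (2 * v₁ + u₁) * (u₁ * v₁ * (u₁ + v₁)) - (2 * u₂ + v₂) * (u₂ * v₂ * (u₂ + v₂)) -
      (2 * u₂ + v₂) * (2 * v₁ + u₁) * (u₃ * v₃ * (u₃ + v₃)) =
    -(3 * u₂ * (u₂ + v₂) * u₃ * v₁ * ((2 * v₁ + u₁) * v₃ + v₂)) := by
  have e₁ := h.norm₁
  have e₂ := h.norm₂
  rw [h.u₃_eq, h.v₃_eq]
  linear_combination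
    -(2 * v₁ + u₁) * (u₁ * v₁ * (u₁ + v₁)) * (1 + (u₂ ^ 2 + u₂ * v₂ + v₂ ^ 2)) * e₂ +
    (2 * u₂ + v₂) * (u₂ * v₂ * (u₂ + v₂)) * (1 + (u₁ ^ 2 + u₁ * v₁ + v₁ ^ 2)) * e₁ -
    3 * u₂ * (u₂ + v₂) * (v₁ * v₂ - u₁ * u₂) * v₁ * v₂ * e₁

theorem identity_circle_snd_fst (h : ThirdAngleData A B C d u₁ v₁ u₂ v₂ u₃ v₃) :
    (2 * u₁ + v₁) * (2 * u₃ + v₃) * (u₂ * v₂ * (u₂ + v₂)) -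
      (2 * u₁ + v₁) * (u₁ * v₁ * (u₁ + v₁)) - (2 * u₃ + v₃) * (u₃ * v₃ * (u₃ + v₃)) =
    3 * u₁ * (u₂ + v₂) * u₃ * (u₃ + v₃) * (v₃ - (2 * u₁ + v₁) * v₂) := by
  have e₁ := h.norm₁
  have e₂ := h.norm₂
  rw [h.u₃_eq, h.v₃_eq]
  linear_combination
    (2 * u₁ + v₁) * (u₁ * v₁ * (u₁ + v₁)) * (1 + (u₂ ^ 2 + u₂ * v₂ + v₂ ^ 2)) * e₂ -
    (2 * u₁ + v₁) * (2 * (v₁ * v₂ - u₁ * u₂) + (u₁ * v₂ + u₁ * u₂ + v₁ * u₂)) *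
      (u₂ * v₂ * (u₂ + v₂)) * e₁

end ThirdAngleData

/-! ### The trigonometric functions behind the relations. -/

namespace ThirdAngle

/-- `2 sin t / √3`. -/
noncomputable def u (t : ℝ) : ℝ := 2 * Real.sin t * √3 / 3

/-- `2 sin (π / 3 - t) / √3`. -/
noncomputable def v (t : ℝ) : ℝ := Real.cos t - Real.sin t * √3 / 3

theorem sin_sub (t : ℝ) : Real.sin (Real.pi / 3 - t) = √3 / 2 * v t := by
  have h3 : √3 ^ 2 = 3 := Real.sq_sqrt (by norm_num)
  rw [Real.sin_sub, Real.sin_pi_div_three, Real.cos_pi_div_three, v]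
  linear_combination Real.sin t / 6 * h3

theorem u_pos {t : ℝ} (h0 : 0 < t) (h : t < Real.pi / 3) : 0 < u t := by
  have := Real.sin_pos_of_pos_of_lt_pi h0 (by linarith [Real.pi_pos])
  unfold u
  positivity

theorem v_pos {t : ℝ} (h0 : 0 < t) (h : t < Real.pi / 3) : 0 < v t := by
  have := Real.sin_pos_of_pos_of_lt_pi (sub_pos.mpr h) (by linarith [Real.pi_pos])
  rw [sin_sub] at this
  exact (mul_pos_iff_of_pos_left (by positivity)).mp this

theorem norm_eq (t : ℝ) : u t ^ 2 + u t * v t + v t ^ 2 = 1 := by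
  have h3 : √3 ^ 2 = 3 := Real.sq_sqrt (by norm_num)
  have hs := Real.sin_sq_add_cos_sq t
  unfold u v
  linear_combination hs + Real.sin t ^ 2 / 3 * h3

theorem two_mul_cos (t : ℝ) : 2 * Real.cos t = 2 * v t + u t := by
  unfold u v
  ring

theorem two_mul_cos_ext (t : ℝ) : 2 * Real.cos (Real.pi / 3 - t) = 2 * u t + v t := by
  rw [Real.cos_sub, Real.sin_pi_div_three, Real.cos_pi_div_three]
  unfold u v
  ring

/-- This is sin 3t = 4 sin t sin (π/3 - t) sin (π/3 + t), where u + v = 2 sin (π/3 + t) / √3. -/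
theorem sin_three_mul (t : ℝ) :
    Real.sin (3 * t) = 3 * √3 / 2 * (u t * v t * (u t + v t)) := by
  have h3 : √3 ^ 2 = 3 := Real.sq_sqrt (by norm_num)
  have hs := Real.sin_sq_add_cos_sq t
  rw [Real.sin_three_mul]
  unfold u v
  linear_combination (-(3 * Real.sin t)) * hs -
    (Real.sin t * Real.cos t ^ 2 - Real.sin t ^ 3 * (√3 ^ 2 + 3) / 9) * h3

theorem u_sub (s t : ℝ) : u (Real.pi / 3 - s - t) = v s * v t - u s * u t := by
  have h3 : √3 ^ 2 = 3 := Real.sq_sqrt (by norm_num)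
  rw [u, sub_sub, sin_sub, v, Real.cos_add, Real.sin_add]
  unfold u v
  linear_combination (Real.cos s * Real.cos t / 3 -
    (Real.sin s * Real.cos t + Real.cos s * Real.sin t) * √3 / 9) * h3

theorem v_sub (s t : ℝ) : v (Real.pi / 3 - s - t) = u s * v t + u s * u t + v s * u t := by
  have h3 : √3 ^ 2 = 3 := Real.sq_sqrt (by norm_num)
  have : √3 / 2 * v (Real.pi / 3 - s - t) = Real.sin (s + t) := by
    rw [← sin_sub]
    congr 1
    ring
  rw [Real.sin_add] at this
  have h : √3 / 2 ≠ 0 := by positivity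
  apply mul_left_cancel₀ h
  rw [this]
  unfold u v
  linear_combination (-(Real.sin s * Real.cos t + Real.cos s * Real.sin t) / 3) * h3

end ThirdAngle

open ThirdAngle in
theorem exists_thirdAngleData {A B C : Plane} (h : AffineIndependent ℝ ![A, B, C]) :
    ∃ d u₁ v₁ u₂ v₂ u₃ v₃, ThirdAngleData A B C d u₁ v₁ u₂ v₂ u₃ v₃ := by
  have hc : ¬Collinear ℝ {A, B, C} := affineIndependent_iff_not_collinear_set.mp h
  have hc₁ : ¬Collinear ℝ {B, A, C} := by rwa [Set.insert_comm]
  have hc₂ : ¬Collinear ℝ {C, B, A} := by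
    rwa [Set.pair_comm, Set.insert_comm, Set.pair_comm]
  have hc₃ : ¬Collinear ℝ {A, C, B} := by rwa [Set.pair_comm]
  have hsum := angle_add_angle_add_angle_eq_pi (p₁ := B) (p₂ := A) C (ne₁₂_of_not_collinear hc)
  have hs₁ : Real.sin (∠ B A C) * dist C A = Real.sin (∠ C B A) * dist B C := by
    rw [dist_comm C A, dist_comm B C]
    exact law_sin B A C
  have hs₂ : Real.sin (∠ B A C) * dist A B = Real.sin (∠ A C B) * dist B C := by
    rw [angle_comm B A C, angle_comm A C B]
    exact law_sin C A B
  have p₁ := angle_pos_of_not_collinear hc₁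
  have p₂ := angle_pos_of_not_collinear hc₂
  have p₃ := angle_pos_of_not_collinear hc₃
  obtain ⟨a, ha⟩ : ∃ a, ∠ B A C = 3 * a := ⟨_ / 3, by ring⟩
  obtain ⟨b, hb⟩ : ∃ b, ∠ C B A = 3 * b := ⟨_ / 3, by ring⟩
  obtain ⟨c, hc⟩ : ∃ c, ∠ A C B = 3 * c := ⟨_ / 3, by ring⟩
  rw [ha, hb, hc] at hsum
  rw [ha] at p₁ hs₁ hs₂
  rw [hb] at p₂ hs₁
  rw [hc] at p₃ hs₂
  have l₁ : a < Real.pi / 3 := by linarith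
  have l₂ : b < Real.pi / 3 := by linarith
  have l₃ : c < Real.pi / 3 := by linarith
  replace p₁ : 0 < a := by linarith
  replace p₂ : 0 < b := by linarith
  replace p₃ : 0 < c := by linarith
  have ea : a = Real.pi / 3 - b - c := by linarith
  have eb : b = Real.pi / 3 - c - a := by linarith
  have ec : c = Real.pi / 3 - a - b := by linarith
  have hu := u_pos p₁ l₁
  have hv := v_pos p₁ l₁
  have h3 : 3 * √3 / 2 ≠ 0 := by positivity
  rw [sin_three_mul, sin_three_mul, mul_assoc (3 * √3 / 2), mul_assoc (3 * √3 / 2),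
    mul_right_inj' h3] at hs₁ hs₂
  have hBC : 0 < dist B C := dist_pos.mpr (ne₁₃_of_not_collinear hc₁)
  -- By the sine law the ratio of a side to its `u * v * (u + v)` is the same for all three sides.
  refine ⟨dist B C / (u a * v a * (u a + v a)), u a, v a, u b, v b, u c, v c,
    { indep := h
      d_pos := by positivity
      u₁_pos := hu
      v₁_pos := hv
      u₂_pos := u_pos p₂ l₂
      v₂_pos := v_pos p₂ l₂
      u₃_pos := u_pos p₃ l₃
      v₃_pos := v_pos p₃ l₃
      norm₁ := norm_eq a
      norm₂ := norm_eq b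
      norm₃ := norm_eq c
      u₁_eq := by rw [← u_sub, ← ea]
      u₂_eq := by rw [← u_sub, ← eb]
      u₃_eq := by rw [← u_sub, ← ec]
      v₁_eq := by rw [← v_sub, ← ea]
      v₂_eq := by rw [← v_sub, ← eb]
      v₃_eq := by rw [← v_sub, ← ec]
      dist_BC := by field_simp
      dist_CA := by rw [div_mul_eq_mul_div, eq_div_iff (by positivity)]; linarith
      dist_AB := by rw [div_mul_eq_mul_div, eq_div_iff (by positivity)]; linarith
      cos₁ := by rw [ha, mul_div_cancel_left₀ _ three_ne_zero, two_mul_cos]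
      cos₂ := by rw [hb, mul_div_cancel_left₀ _ three_ne_zero, two_mul_cos]
      cos₃ := by rw [hc, mul_div_cancel_left₀ _ three_ne_zero, two_mul_cos]
      cos_ext₁ := by rw [ha, sub_div, mul_div_cancel_left₀ _ three_ne_zero, two_mul_cos_ext]
      cos_ext₂ := by rw [hb, sub_div, mul_div_cancel_left₀ _ three_ne_zero, two_mul_cos_ext]
      cos_ext₃ := by rw [hc, sub_div, mul_div_cancel_left₀ _ three_ne_zero, two_mul_cos_ext] }⟩

/-! ### Trisectors of interior and exterior angles, parametrized. -/

theorem OnTrisector.exists_eq {P V Q X : Plane} (h : OnTrisector P V Q X)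
    (hP : P ≠ V) (hQ : Q ≠ V) (hlt : ∠ P V Q < Real.pi) :
    ∃ r : ℝ, X = V + r • ((2 * Real.cos (∠ P V Q / 3) / dist P V) • (P - V) +
      (1 / dist Q V) • (Q - V)) := by
  obtain ⟨-, h₁, h₂⟩ := h
  obtain ⟨r, hr⟩ := eq_smul_of_angle_trisector (p := P - V) (q := Q - V) (x := X - V)
    (t := ∠ P V Q / 3) (sub_ne_zero.mpr hP) (sub_ne_zero.mpr hQ)
    (by rw [mul_div_cancel₀ _ three_ne_zero]; rfl) h₁ (by rw [← mul_div_assoc, ← h₂]; rfl)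
    (div_nonneg (angle_nonneg _ _ _) (by norm_num))
    (by rwa [mul_div_cancel₀ _ three_ne_zero])
  refine ⟨r, ?_⟩
  rw [dist_eq_norm, dist_eq_norm, ← hr]
  abel

theorem pointReflection_sub_self (A B : Plane) : AffineEquiv.pointReflection ℝ B A - B = B - A := by
  simp [Equiv.pointReflection_apply]

theorem angle_pointReflection_right (A B C : Plane) :
    ∠ C B (AffineEquiv.pointReflection ℝ B A) = Real.pi - ∠ C B A := by
  unfold EuclideanGeometry.angle
  rw [← InnerProductGeometry.angle_neg_right, neg_vsub_eq_vsub_rev]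
  congr 1
  exact pointReflection_sub_self A B

theorem dist_pointReflection_self (A B : Plane) :
    dist (AffineEquiv.pointReflection ℝ B A) B = dist A B := by
  rw [dist_eq_norm, pointReflection_sub_self, ← dist_eq_norm, dist_comm]

theorem OnTrisector.exists_eq_of_exterior_left {A B C X : Plane}
    (h : OnTrisector C B (AffineEquiv.pointReflection ℝ B A) X)
    (hc : ¬Collinear ℝ {C, B, A}) :
    ∃ r : ℝ, X = B + r • ((2 * Real.cos ((Real.pi - ∠ C B A) / 3) / dist B C) • (C - B) +
      (1 / dist A B) • (B - A)) := by
  have hAB := ne₂₃_of_not_collinear hc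
  obtain ⟨r, hr⟩ := h.exists_eq (ne₁₂_of_not_collinear hc)
    (by rwa [← dist_pos, dist_pointReflection_self, dist_pos, ne_comm])
    (by rw [angle_pointReflection_right]; linarith [angle_pos_of_not_collinear hc])
  refine ⟨r, ?_⟩
  rwa [dist_pointReflection_self, pointReflection_sub_self, angle_pointReflection_right,
    dist_comm C B] at hr

theorem OnTrisector.exists_eq_of_exterior_right {A B C X : Plane}
    (h : OnTrisector (AffineEquiv.pointReflection ℝ B A) B C X)
    (hc : ¬Collinear ℝ {C, B, A}) :
    ∃ r : ℝ, X = B + r • ((2 * Real.cos ((Real.pi - ∠ C B A) / 3) / dist A B) • (B - A) +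
      (1 / dist B C) • (C - B)) := by
  have hAB := ne₂₃_of_not_collinear hc
  obtain ⟨r, hr⟩ := h.exists_eq
    (by rwa [← dist_pos, dist_pointReflection_self, dist_pos, ne_comm])
    (ne₁₂_of_not_collinear hc)
    (by rw [angle_comm, angle_pointReflection_right]; linarith [angle_pos_of_not_collinear hc])
  refine ⟨r, ?_⟩
  rwa [dist_pointReflection_self, pointReflection_sub_self, angle_comm,
    angle_pointReflection_right, dist_comm C B] at hr

theorem IsExternalMorleyTriangle.swap {A B C X Y Z : Plane}
    (h : IsExternalMorleyTriangle A B C X Y Z) : IsExternalMorleyTriangle A C B X Z Y :=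
  ⟨h.fst_C, h.fst_B, h.trd_A, h.trd_C, h.snd_A, h.snd_B⟩

/-! ### Barycentric coordinates of the Morley vertices. -/

namespace ThirdAngleData

variable {A B C : Plane} {d u₁ v₁ u₂ v₂ u₃ v₃ : ℝ}

theorem not_collinear (h : ThirdAngleData A B C d u₁ v₁ u₂ v₂ u₃ v₃) :
    ¬Collinear ℝ {A, B, C} := affineIndependent_iff_not_collinear_set.mp h.indep

theorem not_collinear_rev (h : ThirdAngleData A B C d u₁ v₁ u₂ v₂ u₃ v₃) :
    ¬Collinear ℝ {C, B, A} := affineIndependent_iff_not_collinear_set.mp h.rotate.rotate.swap.indep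

theorem sum_fst (h : ThirdAngleData A B C d u₁ v₁ u₂ v₂ u₃ v₃) :
    -(u₁ * v₁ / (3 * u₂ * (u₂ + v₂) * u₃ * (u₃ + v₃))) +
      (2 * u₃ + v₃) * v₂ / (3 * u₃ * (u₃ + v₃) * (u₁ + v₁)) +
      (2 * u₂ + v₂) * v₃ / (3 * u₂ * (u₂ + v₂) * (u₁ + v₁)) = 1 := by
  have e := h.identity_fst
  obtain ⟨-, -, h1, h2, h3, h4, h5, h6, -⟩ := h
  have : u₁ + v₁ ≠ 0 := by positivity
  have : u₂ + v₂ ≠ 0 := by positivity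
  have : u₃ + v₃ ≠ 0 := by positivity
  field_simp
  linear_combination e

theorem sum_snd (h : ThirdAngleData A B C d u₁ v₁ u₂ v₂ u₃ v₃) :
    -(u₁ * (2 * u₂ + v₂) / (3 * u₃ * u₂ * (u₂ + v₂))) +
      (2 * v₁ + u₁) * v₂ / (3 * v₁ * (u₁ + v₁) * u₃) +
      v₃ * (u₃ + v₃) / (3 * u₂ * (u₂ + v₂) * v₁ * (u₁ + v₁)) = 1 := by
  have e := h.identity_snd
  obtain ⟨-, -, h1, h2, h3, h4, h5, h6, -⟩ := h
  have : u₁ + v₁ ≠ 0 := by positivity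
  have : u₂ + v₂ ≠ 0 := by positivity
  have : u₃ + v₃ ≠ 0 := by positivity
  field_simp
  linear_combination e

/-- Barycentric coordinates of the vertex of the external Morley triangle on the side `BC`. -/
theorem fst_eq (h : ThirdAngleData A B C d u₁ v₁ u₂ v₂ u₃ v₃) {X Y Z : Plane}
    (hM : IsExternalMorleyTriangle A B C X Y Z) :
    X = (-(u₁ * v₁ / (3 * u₂ * (u₂ + v₂) * u₃ * (u₃ + v₃)))) • A +
      ((2 * u₃ + v₃) * v₂ / (3 * u₃ * (u₃ + v₃) * (u₁ + v₁))) • B +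
      ((2 * u₂ + v₂) * v₃ / (3 * u₂ * (u₂ + v₂) * (u₁ + v₁))) • C := by
  obtain ⟨r, hr⟩ := hM.fst_B.exists_eq_of_exterior_left h.not_collinear_rev
  obtain ⟨s, hs⟩ := hM.fst_C.exists_eq_of_exterior_left h.swap.not_collinear_rev
  rw [h.cos_ext₂, h.dist_BC, h.dist_AB] at hr
  rw [h.swap.cos_ext₂, h.swap.dist_BC, h.swap.dist_AB] at hs
  have e := h.identity_fst
  have hsum := h.sum_fst
  have hi := h.indep
  obtain ⟨-, hd, h1, h2, h3, h4, h5, h6, -⟩ := h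
  set a := d * (u₁ * v₁ * (u₁ + v₁)) with ha
  set b := d * (u₂ * v₂ * (u₂ + v₂)) with hb
  set c := d * (u₃ * v₃ * (u₃ + v₃)) with hc
  have ha0 : a ≠ 0 := by positivity
  have hb0 : b ≠ 0 := by positivity
  have hc0 : c ≠ 0 := by positivity
  -- The two parametrizations of X are compared along B - A and C - A. The sum of the two equations
  -- gives r/c = s/b, and `identity_fst` then yields r.
  obtain ⟨e1, e2⟩ := eq_zero_of_smul_add_smul_sub hi
    (s := 1 + r * (1 / c - (2 * u₂ + v₂) / a) - s * ((2 * u₃ + v₃) / a))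
    (t := r * ((2 * u₂ + v₂) / a) - 1 - s * (1 / b - (2 * u₃ + v₃) / a))
    (by rw [← sub_eq_zero.mpr (hr.symm.trans hs)]; module)
  have e3 : r / c = u₁ * v₁ / (3 * u₂ * (u₂ + v₂) * u₃ * (u₃ + v₃)) := by
    have hsr : s = r * b / c := by
      field_simp
      have : r * (1 / c) = s * (1 / b) := by linear_combination e1 + e2
      field_simp at this
      linarith
    have hS : 0 < 3 * u₂ * (u₂ + v₂) * u₃ * (u₃ + v₃) * (u₁ + v₁) := by positivity
    rw [hsr] at e2
    field_simp at e2
    have e4 : r * d * (3 * u₂ * (u₂ + v₂) * u₃ * (u₃ + v₃) * (u₁ + v₁)) = a * c := by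
      rw [← e]
      linear_combination e2 + r * ((2 * u₂ + v₂) * hc + (2 * u₃ + v₃) * hb - ha)
    rw [div_eq_div_iff hc0 (by positivity)]
    apply mul_right_cancel₀ (show d * (u₁ + v₁) ≠ 0 by positivity)
    linear_combination e4 + c * ha
  have e5 : r = c * (u₁ * v₁ / (3 * u₂ * (u₂ + v₂) * u₃ * (u₃ + v₃))) := by
    rw [← e3]; field_simp
  have hz : r * ((2 * u₂ + v₂) / a) =
      (2 * u₂ + v₂) * v₃ / (3 * u₂ * (u₂ + v₂) * (u₁ + v₁)) := by
    rw [e5, ha, hc]; field_simp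
  rw [hr]
  rw [show (2 * u₃ + v₃) * v₂ / (3 * u₃ * (u₃ + v₃) * (u₁ + v₁)) =
    1 + r / c - r * ((2 * u₂ + v₂) / a) by rw [hz, e3]; linear_combination hsum,
    ← hz, ← e3]
  module

/-- Barycentric coordinates of the vertex of the external Morley triangle on the side `AB`. -/
theorem snd_eq (h : ThirdAngleData A B C d u₁ v₁ u₂ v₂ u₃ v₃) {X Y Z : Plane}
    (hM : IsExternalMorleyTriangle A B C X Y Z) :
    Y = (-(u₁ * (2 * u₂ + v₂) / (3 * u₃ * u₂ * (u₂ + v₂)))) • A +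
      ((2 * v₁ + u₁) * v₂ / (3 * v₁ * (u₁ + v₁) * u₃)) • B +
      (v₃ * (u₃ + v₃) / (3 * u₂ * (u₂ + v₂) * v₁ * (u₁ + v₁))) • C := by
  have hcol := h.not_collinear
  obtain ⟨r, hr⟩ := hM.snd_A.exists_eq (ne₁₂_of_not_collinear hcol).symm
    (ne₁₃_of_not_collinear hcol).symm
    (angle_lt_pi_of_not_collinear (by rwa [Set.insert_comm]))
  obtain ⟨s, hs⟩ := hM.snd_B.exists_eq_of_exterior_right h.not_collinear_rev
  rw [h.cos₁, h.dist_CA, dist_comm, h.dist_AB] at hr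
  rw [h.cos_ext₂, h.dist_BC, h.dist_AB] at hs
  have e := h.identity_snd
  have hsum := h.sum_snd
  have hi := h.indep
  obtain ⟨-, hd, h1, h2, h3, h4, h5, h6, -⟩ := h
  set a := d * (u₁ * v₁ * (u₁ + v₁)) with ha
  set b := d * (u₂ * v₂ * (u₂ + v₂)) with hb
  set c := d * (u₃ * v₃ * (u₃ + v₃)) with hc
  have ha0 : a ≠ 0 := by positivity
  have hb0 : b ≠ 0 := by positivity
  have hc0 : c ≠ 0 := by positivity
  obtain ⟨e1, e2⟩ := eq_zero_of_smul_add_smul_sub hi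
    (s := r * ((2 * v₁ + u₁) / c) - 1 - s * ((2 * u₂ + v₂) / c) + s * (1 / a))
    (t := r * (1 / b) - s * (1 / a))
    (by rw [← sub_eq_zero.mpr (hr.symm.trans hs)]; module)
  have e3 : r / b = v₃ * (u₃ + v₃) / (3 * u₂ * (u₂ + v₂) * v₁ * (u₁ + v₁)) := by
    have hsr : s = r * a / b := by
      field_simp at e2 ⊢
      linarith
    rw [hsr] at e1
    field_simp at e1
    have e4 : r * d * (3 * u₂ * (u₂ + v₂) * v₁ * (u₁ + v₁) * u₃) = b * c := by
      rw [← e]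
      linear_combination e1 + r * ((2 * v₁ + u₁) * hb - (2 * u₂ + v₂) * ha + hc)
    rw [div_eq_div_iff hb0 (by positivity)]
    apply mul_right_cancel₀ (show d * u₃ ≠ 0 by positivity)
    linear_combination e4 + b * hc
  have e5 : r = b * (v₃ * (u₃ + v₃) / (3 * u₂ * (u₂ + v₂) * v₁ * (u₁ + v₁))) := by
    rw [← e3]; field_simp
  have hy : r * ((2 * v₁ + u₁) / c) = (2 * v₁ + u₁) * v₂ / (3 * v₁ * (u₁ + v₁) * u₃) := by
    rw [e5, hb, hc]; field_simp
  rw [hr]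
  rw [show -(u₁ * (2 * u₂ + v₂) / (3 * u₃ * u₂ * (u₂ + v₂))) =
    1 - r * ((2 * v₁ + u₁) / c) - r / b by rw [hy, e3]; linear_combination hsum,
    ← hy, ← e3]
  module

/-- Barycentric coordinates of the vertex of the external Morley triangle on the side `AC`. -/
theorem trd_eq (h : ThirdAngleData A B C d u₁ v₁ u₂ v₂ u₃ v₃) {X Y Z : Plane}
    (hM : IsExternalMorleyTriangle A B C X Y Z) :
    Z = (-(u₁ * (2 * u₃ + v₃) / (3 * u₂ * u₃ * (u₃ + v₃)))) • A +
      (v₂ * (u₂ + v₂) / (3 * u₃ * (u₃ + v₃) * v₁ * (u₁ + v₁))) • B +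
      ((2 * v₁ + u₁) * v₃ / (3 * v₁ * (u₁ + v₁) * u₂)) • C := by
  rw [h.swap.snd_eq hM.swap]
  abel

end ThirdAngleData

/-! ### The Morley vertices satisfy the circle equations. -/

namespace ThirdAngleData

variable {A B C : Plane} {d u₁ v₁ u₂ v₂ u₃ v₃ : ℝ}

/-- The circle equation of the triangle `A_A A_B A_C` at `A_A`. -/
theorem circle_fst_fst (h : ThirdAngleData A B C d u₁ v₁ u₂ v₂ u₃ v₃) {x y z : ℝ}
    (hx : x = -(u₁ * v₁ / (3 * u₂ * (u₂ + v₂) * u₃ * (u₃ + v₃))))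
    (hy : y = (2 * u₃ + v₃) * v₂ / (3 * u₃ * (u₃ + v₃) * (u₁ + v₁)))
    (hz : z = (2 * u₂ + v₂) * v₃ / (3 * u₂ * (u₂ + v₂) * (u₁ + v₁))) :
    x * -(d ^ 2 * (u₁ + v₁) * (u₂ * v₂ * (u₂ + v₂)) * (u₃ * v₃ * (u₃ + v₃))) +
      y * -(d ^ 2 * u₁ * v₁ ^ 2 * v₂ * (u₃ * v₃ * (u₃ + v₃))) +
      z * -(d ^ 2 * u₁ * v₁ ^ 2 * v₃ * (u₂ * v₂ * (u₂ + v₂))) =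
    y * z * dist B C ^ 2 + z * x * dist C A ^ 2 + x * y * dist A B ^ 2 := by
  have e := h.identity_circle_fst_fst
  rw [h.dist_BC, h.dist_CA, h.dist_AB, hx, hy, hz]
  obtain ⟨-, -, h1, h2, h3, h4, h5, h6, -⟩ := h
  have : u₁ + v₁ ≠ 0 := by positivity
  have : u₂ + v₂ ≠ 0 := by positivity
  have : u₃ + v₃ ≠ 0 := by positivity
  rw [← sub_eq_zero]
  rw [← sub_eq_zero] at e
  -- The circle equation is this rational multiple of the polynomial identity `e`.
  refine Eq.trans ?_ (congrArg (-(d ^ 2 * u₁ * v₁ * v₂ * v₃ /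
    (9 * u₂ * (u₂ + v₂) * u₃ * (u₃ + v₃) * (u₁ + v₁))) * ·) e |>.trans (mul_zero _))
  field_simp
  ring

/-- The circle equation of the triangle `A_A A_B A_C` at `A_B`. -/
theorem circle_fst_trd (h : ThirdAngleData A B C d u₁ v₁ u₂ v₂ u₃ v₃) {x y z : ℝ}
    (hy : y = -(u₂ * (2 * u₁ + v₁) / (3 * u₃ * u₁ * (u₁ + v₁))))
    (hz : z = v₃ * (u₃ + v₃) / (3 * u₁ * (u₁ + v₁) * v₂ * (u₂ + v₂)))
    (hx : x = (2 * v₂ + u₂) * v₁ / (3 * v₂ * (u₂ + v₂) * u₃)) :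
    x * -(d ^ 2 * (u₁ + v₁) * (u₂ * v₂ * (u₂ + v₂)) * (u₃ * v₃ * (u₃ + v₃))) +
      y * -(d ^ 2 * u₁ * v₁ ^ 2 * v₂ * (u₃ * v₃ * (u₃ + v₃))) +
      z * -(d ^ 2 * u₁ * v₁ ^ 2 * v₃ * (u₂ * v₂ * (u₂ + v₂))) =
    y * z * dist B C ^ 2 + z * x * dist C A ^ 2 + x * y * dist A B ^ 2 := by
  have e := h.identity_circle_fst_trd
  rw [h.dist_BC, h.dist_CA, h.dist_AB, hx, hy, hz]
  obtain ⟨-, -, h1, h2, h3, h4, h5, h6, -⟩ := h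
  have : u₁ + v₁ ≠ 0 := by positivity
  have : u₂ + v₂ ≠ 0 := by positivity
  have : u₃ + v₃ ≠ 0 := by positivity
  rw [← sub_eq_zero]
  rw [← sub_eq_zero] at e
  refine Eq.trans ?_ (congrArg (-(d ^ 2 * v₁ * u₂ * v₃ * (u₃ + v₃) /
    (9 * u₃ * v₂ * (u₂ + v₂) * u₁ * (u₁ + v₁))) * ·) e |>.trans (mul_zero _))
  field_simp
  ring

/-- The circle equation of the quadrangle `C_A B_A B_B C_C` at `B_A`. -/
theorem circle_snd_snd (h : ThirdAngleData A B C d u₁ v₁ u₂ v₂ u₃ v₃) {x y z : ℝ}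
    (hx : x = -(u₁ * (2 * u₂ + v₂) / (3 * u₃ * u₂ * (u₂ + v₂))))
    (hy : y = (2 * v₁ + u₁) * v₂ / (3 * v₁ * (u₁ + v₁) * u₃))
    (hz : z = v₃ * (u₃ + v₃) / (3 * u₂ * (u₂ + v₂) * v₁ * (u₁ + v₁))) :
    x * 0 + y * -(d ^ 2 * u₁ * v₁ * (u₃ * v₃ ^ 2 * (u₃ + v₃))) +
      z * -(d ^ 2 * u₁ * v₁ * (u₂ * v₂ ^ 2 * (u₂ + v₂))) =
    y * z * dist B C ^ 2 + z * x * dist C A ^ 2 + x * y * dist A B ^ 2 := by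
  have e := h.identity_circle_snd_snd
  rw [h.dist_BC, h.dist_CA, h.dist_AB, hx, hy, hz]
  obtain ⟨-, -, h1, h2, h3, h4, h5, h6, -⟩ := h
  have : u₁ + v₁ ≠ 0 := by positivity
  have : u₂ + v₂ ≠ 0 := by positivity
  have : u₃ + v₃ ≠ 0 := by positivity
  rw [← sub_eq_zero]
  rw [← sub_eq_zero] at e
  refine Eq.trans ?_ (congrArg (-(d ^ 2 * u₁ * v₂ * v₃ * (u₃ + v₃) /
    (9 * u₃ * u₂ * (u₂ + v₂) * v₁ * (u₁ + v₁))) * ·) e |>.trans (mul_zero _))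
  field_simp
  ring

/-- The circle equation of the quadrangle `C_A B_A B_B C_C` at `B_B`. -/
theorem circle_snd_fst (h : ThirdAngleData A B C d u₁ v₁ u₂ v₂ u₃ v₃) {x y z : ℝ}
    (hy : y = -(u₂ * v₂ / (3 * u₃ * (u₃ + v₃) * u₁ * (u₁ + v₁))))
    (hz : z = (2 * u₁ + v₁) * v₃ / (3 * u₁ * (u₁ + v₁) * (u₂ + v₂)))
    (hx : x = (2 * u₃ + v₃) * v₁ / (3 * u₃ * (u₃ + v₃) * (u₂ + v₂))) :
    x * 0 + y * -(d ^ 2 * u₁ * v₁ * (u₃ * v₃ ^ 2 * (u₃ + v₃))) +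
      z * -(d ^ 2 * u₁ * v₁ * (u₂ * v₂ ^ 2 * (u₂ + v₂))) =
    y * z * dist B C ^ 2 + z * x * dist C A ^ 2 + x * y * dist A B ^ 2 := by
  have e := h.identity_circle_snd_fst
  rw [h.dist_BC, h.dist_CA, h.dist_AB, hx, hy, hz]
  obtain ⟨-, -, h1, h2, h3, h4, h5, h6, -⟩ := h
  have : u₁ + v₁ ≠ 0 := by positivity
  have : u₂ + v₂ ≠ 0 := by positivity
  have : u₃ + v₃ ≠ 0 := by positivity
  rw [← sub_eq_zero]
  rw [← sub_eq_zero] at e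
  refine Eq.trans ?_ (congrArg (-(d ^ 2 * v₁ * v₃ * u₂ * v₂ /
    (9 * u₁ * (u₁ + v₁) * u₃ * (u₃ + v₃) * (u₂ + v₂))) * ·) e |>.trans (mul_zero _))
  field_simp
  ring

end ThirdAngleData

/-! ### The two circles at each vertex and their radical line. -/

/-- `P` has barycentric coordinates `x, y, z` with respect to `A B C`, and they satisfy the
equation of the circle with respect to which `A, B, C` have the powers `p, q, r`. -/
structure CircleCoords (A B C P : Plane) (p q r x y z : ℝ) : Prop where
  sum : x + y + z = 1
  eq : P = x • A + y • B + z • C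
  circle : x * p + y * q + z * r =
    y * z * dist B C ^ 2 + z * x * dist C A ^ 2 + x * y * dist A B ^ 2

namespace CircleCoords

variable {A B C P Q : Plane} {p q r p' q' r' x y z x' y' z' : ℝ}

theorem swap (h : CircleCoords A C B P p r q x z y) : CircleCoords A B C P p q r x y z where
  sum := by linarith [h.sum]
  eq := by rw [h.eq]; abel
  circle := by
    rw [dist_comm B C, dist_comm C A, dist_comm A B]
    linarith [h.circle]

theorem mem (h : CircleCoords A B C P p q r x y z) {ω : Sphere Plane} (hω : 0 ≤ ω.radius)
    (hA : ω.power A = p) (hB : ω.power B = q) (hC : ω.power C = r) : P ∈ (ω : Set Plane) := by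
  rw [Metric.mem_sphere, ← mem_sphere, ← Sphere.power_eq_zero_iff_mem_sphere hω, h.eq,
    power_barycentric ω A B C h.sum, hA, hB, hC, h.circle, sub_self]

theorem ne (h : CircleCoords A B C P p q r x y z) (h' : CircleCoords A B C Q p' q' r' x' y' z')
    (hi : AffineIndependent ℝ ![A, B, C]) (hne : x ≠ x' ∨ y ≠ y' ∨ z ≠ z') : P ≠ Q := by
  intro hPQ
  obtain ⟨h1, h2, h3⟩ := eq_zero_of_barycentric_eq_zero hi (x := x - x') (y := y - y')
    (z := z - z') (by linarith [h.sum, h'.sum])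
    (by rw [← sub_eq_zero.mpr (h.eq.symm.trans (hPQ.trans h'.eq))]; module)
  rcases hne with hne | hne | hne
  · exact hne (sub_eq_zero.mp h1)
  · exact hne (sub_eq_zero.mp h2)
  · exact hne (sub_eq_zero.mp h3)

end CircleCoords

namespace ThirdAngleData

variable {A B C X Y Z : Plane} {d u₁ v₁ u₂ v₂ u₃ v₃ : ℝ}

/-- The powers agree across the `coords_fst_*` lemmas, so one sphere serves all three points; the
signs of the coordinates serve to tell the points apart. -/
theorem coords_fst_fst (h : ThirdAngleData A B C d u₁ v₁ u₂ v₂ u₃ v₃)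
    (hM : IsExternalMorleyTriangle A B C X Y Z) :
    ∃ x y z, x < 0 ∧ 0 < y ∧ 0 < z ∧ CircleCoords A B C X
      (-(d ^ 2 * (u₁ + v₁) * (u₂ * v₂ * (u₂ + v₂)) * (u₃ * v₃ * (u₃ + v₃))))
      (-(d ^ 2 * u₁ * v₁ ^ 2 * v₂ * (u₃ * v₃ * (u₃ + v₃))))
      (-(d ^ 2 * u₁ * v₁ ^ 2 * v₃ * (u₂ * v₂ * (u₂ + v₂)))) x y z := by
  have hh := h
  obtain ⟨-, hd, h1, h2, h3, h4, h5, h6, -⟩ := hh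
  exact ⟨_, _, _, neg_neg_of_pos (by positivity), by positivity, by positivity,
    h.sum_fst, h.fst_eq hM, h.circle_fst_fst rfl rfl rfl⟩

theorem coords_fst_trd (h : ThirdAngleData A B C d u₁ v₁ u₂ v₂ u₃ v₃)
    (hM : IsExternalMorleyTriangle B C A X Y Z) :
    ∃ x y z, 0 < x ∧ y < 0 ∧ 0 < z ∧ CircleCoords A B C Z
      (-(d ^ 2 * (u₁ + v₁) * (u₂ * v₂ * (u₂ + v₂)) * (u₃ * v₃ * (u₃ + v₃))))
      (-(d ^ 2 * u₁ * v₁ ^ 2 * v₂ * (u₃ * v₃ * (u₃ + v₃))))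
      (-(d ^ 2 * u₁ * v₁ ^ 2 * v₃ * (u₂ * v₂ * (u₂ + v₂)))) x y z := by
  have hh := h
  obtain ⟨-, hd, h1, h2, h3, h4, h5, h6, -⟩ := hh
  refine ⟨_, _, _, ?_, ?_, ?_, by linarith [h.rotate.swap.sum_snd],
    (h.rotate.trd_eq hM).trans (by abel), h.circle_fst_trd rfl rfl rfl⟩
  · positivity
  · exact neg_neg_of_pos (by positivity)
  · positivity

theorem coords_fst_snd (h : ThirdAngleData A B C d u₁ v₁ u₂ v₂ u₃ v₃)
    (hM : IsExternalMorleyTriangle C A B X Y Z) :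
    ∃ x y z, 0 < x ∧ 0 < y ∧ z < 0 ∧ CircleCoords A B C Y
      (-(d ^ 2 * (u₁ + v₁) * (u₂ * v₂ * (u₂ + v₂)) * (u₃ * v₃ * (u₃ + v₃))))
      (-(d ^ 2 * u₁ * v₁ ^ 2 * v₂ * (u₃ * v₃ * (u₃ + v₃))))
      (-(d ^ 2 * u₁ * v₁ ^ 2 * v₃ * (u₂ * v₂ * (u₂ + v₂)))) x y z := by
  obtain ⟨x, z, y, hx, hz, hy, hc⟩ := h.swap.coords_fst_trd hM.swap
  refine ⟨x, y, z, hx, hy, hz, ?_⟩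
  rw [mul_right_comm] at hc
  exact hc.swap

theorem coords_snd_snd (h : ThirdAngleData A B C d u₁ v₁ u₂ v₂ u₃ v₃)
    (hM : IsExternalMorleyTriangle A B C X Y Z) :
    ∃ x y z, x < 0 ∧ 0 < y ∧ 0 < z ∧ CircleCoords A B C Y 0
      (-(d ^ 2 * u₁ * v₁ * (u₃ * v₃ ^ 2 * (u₃ + v₃))))
      (-(d ^ 2 * u₁ * v₁ * (u₂ * v₂ ^ 2 * (u₂ + v₂)))) x y z := by
  have hh := h
  obtain ⟨-, hd, h1, h2, h3, h4, h5, h6, -⟩ := hh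
  exact ⟨_, _, _, neg_neg_of_pos (by positivity), by positivity, by positivity,
    h.sum_snd, h.snd_eq hM, h.circle_snd_snd rfl rfl rfl⟩

theorem coords_snd_trd (h : ThirdAngleData A B C d u₁ v₁ u₂ v₂ u₃ v₃)
    (hM : IsExternalMorleyTriangle A B C X Y Z) :
    ∃ x y z, x < 0 ∧ 0 < y ∧ 0 < z ∧ CircleCoords A B C Z 0
      (-(d ^ 2 * u₁ * v₁ * (u₃ * v₃ ^ 2 * (u₃ + v₃))))
      (-(d ^ 2 * u₁ * v₁ * (u₂ * v₂ ^ 2 * (u₂ + v₂)))) x y z := by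
  obtain ⟨x, z, y, hx, hz, hy, hc⟩ := h.swap.coords_snd_snd hM.swap
  exact ⟨x, y, z, hx, hy, hz, hc.swap⟩

theorem coords_snd_fst (h : ThirdAngleData A B C d u₁ v₁ u₂ v₂ u₃ v₃)
    (hM : IsExternalMorleyTriangle B C A X Y Z) :
    ∃ x y z, 0 < x ∧ y < 0 ∧ 0 < z ∧ CircleCoords A B C X 0
      (-(d ^ 2 * u₁ * v₁ * (u₃ * v₃ ^ 2 * (u₃ + v₃))))
      (-(d ^ 2 * u₁ * v₁ * (u₂ * v₂ ^ 2 * (u₂ + v₂)))) x y z := by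
  have hh := h
  obtain ⟨-, hd, h1, h2, h3, h4, h5, h6, -⟩ := hh
  refine ⟨_, _, _, ?_, ?_, ?_, by linarith [h.rotate.sum_fst],
    (h.rotate.fst_eq hM).trans (by abel), h.circle_snd_fst rfl rfl rfl⟩
  · positivity
  · exact neg_neg_of_pos (by positivity)
  · positivity

theorem coords_snd_fst' (h : ThirdAngleData A B C d u₁ v₁ u₂ v₂ u₃ v₃)
    (hM : IsExternalMorleyTriangle C A B X Y Z) :
    ∃ x y z, 0 < x ∧ 0 < y ∧ z < 0 ∧ CircleCoords A B C X 0
      (-(d ^ 2 * u₁ * v₁ * (u₃ * v₃ ^ 2 * (u₃ + v₃))))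
      (-(d ^ 2 * u₁ * v₁ * (u₂ * v₂ ^ 2 * (u₂ + v₂)))) x y z := by
  obtain ⟨x, z, y, hx, hz, hy, hc⟩ := h.swap.coords_snd_fst hM.swap
  exact ⟨x, y, z, hx, hy, hz, hc.swap⟩

/-- The two circles belonging to the vertex `A`, and the equation of their radical line in
barycentric coordinates. -/
theorem exists_circles (h : ThirdAngleData A B C d u₁ v₁ u₂ v₂ u₃ v₃)
    {X₁ Y₁ Z₁ X₂ Y₂ Z₂ X₃ Y₃ Z₃ : Plane}
    (hA : IsExternalMorleyTriangle A B C X₁ Y₁ Z₁)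
    (hB : IsExternalMorleyTriangle B C A X₂ Y₂ Z₂)
    (hC : IsExternalMorleyTriangle C A B X₃ Y₃ Z₃) :
    ∃ ω₁ ω₂ : Sphere Plane, IsCircleThrough ω₁ {X₁, Z₂, Y₃} ∧
      IsCircleThrough ω₂ {Z₁, Y₁, X₂, X₃} ∧ ∃ k : ℝ, k ≠ 0 ∧ ∀ x y z : ℝ, x + y + z = 1 →
        ω₁.power (x • A + y • B + z • C) - ω₂.power (x • A + y • B + z • C) =
          k * (x * ((u₂ * v₂ * (u₂ + v₂)) * (u₃ * v₃ * (u₃ + v₃)) * (1 - ((v₁ - u₁) / 2) ^ 2)) +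
            y * ((u₃ * v₃ * (u₃ + v₃)) * (u₁ * v₁ * (u₁ + v₁)) *
              ((v₁ - u₁) / 2 * ((v₂ - u₂) / 2) - (v₃ - u₃) / 2)) +
            z * ((u₁ * v₁ * (u₁ + v₁)) * (u₂ * v₂ * (u₂ + v₂)) *
              ((v₃ - u₃) / 2 * ((v₁ - u₁) / 2) - (v₂ - u₂) / 2))) := by
  obtain ⟨x₁, y₁, z₁, hx₁, hy₁, hz₁, c₁⟩ := h.coords_fst_fst hA
  obtain ⟨x₂, y₂, z₂, hx₂, hy₂, hz₂, c₂⟩ := h.coords_fst_trd hB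
  obtain ⟨x₃, y₃, z₃, hx₃, hy₃, hz₃, c₃⟩ := h.coords_fst_snd hC
  obtain ⟨x₄, y₄, z₄, hx₄, hy₄, hz₄, c₄⟩ := h.coords_snd_trd hA
  obtain ⟨x₅, y₅, z₅, hx₅, hy₅, hz₅, c₅⟩ := h.coords_snd_snd hA
  obtain ⟨x₆, y₆, z₆, hx₆, hy₆, hz₆, c₆⟩ := h.coords_snd_fst hB
  obtain ⟨x₇, y₇, z₇, hx₇, hy₇, hz₇, c₇⟩ := h.coords_snd_fst' hC
  obtain ⟨ω₁, hr₁, hA₁, hB₁, hC₁⟩ := exists_sphere_power_eq h.indep _ _ _ c₁.sum c₁.circle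
  obtain ⟨ω₂, hr₂, hA₂, hB₂, hC₂⟩ := exists_sphere_power_eq h.indep _ _ _ c₄.sum c₄.circle
  refine ⟨ω₁, ω₂, ?_, ?_, -(4 * d ^ 2 / (3 * (u₁ + v₁))), ?_, ?_⟩
  · refine isCircleThrough_of_three (P := X₁) (Q := Z₂) (R := Y₃) ?_ (by simp) (by simp) (by simp)
      (c₁.ne c₂ h.indep (.inl (by linarith))) (c₁.ne c₃ h.indep (.inl (by linarith)))
      (c₂.ne c₃ h.indep (.inr (.inl (by linarith))))
    rintro _ (rfl | rfl | rfl)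
    exacts [c₁.mem hr₁ hA₁ hB₁ hC₁, c₂.mem hr₁ hA₁ hB₁ hC₁, c₃.mem hr₁ hA₁ hB₁ hC₁]
  -- Y₁ is left out: it has the same sign pattern as Z₁, and three distinct points suffice.
  · refine isCircleThrough_of_three (P := Z₁) (Q := X₂) (R := X₃) ?_ (by simp) (by simp) (by simp)
      (c₄.ne c₆ h.indep (.inl (by linarith))) (c₄.ne c₇ h.indep (.inl (by linarith)))
      (c₆.ne c₇ h.indep (.inr (.inl (by linarith))))
    rintro _ (rfl | rfl | rfl | rfl)
    exacts [c₄.mem hr₂ hA₂ hB₂ hC₂, c₅.mem hr₂ hA₂ hB₂ hC₂, c₆.mem hr₂ hA₂ hB₂ hC₂,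
      c₇.mem hr₂ hA₂ hB₂ hC₂]
  · have := h.d_pos
    have := h.u₁_pos
    have := h.v₁_pos
    rw [neg_ne_zero]
    positivity
  · intro x y z hs
    rw [power_barycentric _ _ _ _ hs, power_barycentric _ _ _ _ hs, hA₁, hB₁, hC₁, hA₂, hB₂, hC₂]
    have hW : u₁ + v₁ ≠ 0 := (add_pos h.u₁_pos h.v₁_pos).ne'
    -- These express the adjugate entries through u and v; the factor 3/4 is absorbed by the
    -- constant k.
    have e₁ : 1 - ((v₁ - u₁) / 2) ^ 2 = 3 / 4 * (u₁ + v₁) ^ 2 := by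
      linear_combination -h.norm₁
    have e₂ : (v₁ - u₁) / 2 * ((v₂ - u₂) / 2) - (v₃ - u₃) / 2 = 3 / 4 * (v₁ * v₂ - v₃) := by
      linear_combination 1 / 4 * h.v₃_eq + 1 / 2 * h.u₃_eq
    have e₃ : (v₃ - u₃) / 2 * ((v₁ - u₁) / 2) - (v₂ - u₂) / 2 = 3 / 4 * (v₁ * v₃ - v₂) := by
      linear_combination 1 / 4 * h.v₂_eq + 1 / 2 * h.u₂_eq
    rw [e₁, e₂, e₃]
    field_simp
    ring

end ThirdAngleData

/-! ### Bounds on σᵢ and positivity of the normalizing sums. -/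

namespace ThirdAngleData

variable {A B C : Plane} {d u₁ v₁ u₂ v₂ u₃ v₃ : ℝ}

/-- Indeed (v₁ - u₁)² = 1 - 3u₁v₁ < 1. -/
theorem abs_sigma_lt (h : ThirdAngleData A B C d u₁ v₁ u₂ v₂ u₃ v₃) :
    |(v₁ - u₁) / 2| < 1 / 2 := by
  have := mul_pos h.u₁_pos h.v₁_pos
  have := h.norm₁
  rw [abs_lt]
  constructor <;> nlinarith

/-- Twice the sum equals (v₂ + v₃)(1 - v₁) + u₁(u₂ + u₃). Hence at most one σᵢ is nonpositive. -/
theorem sigma_add_pos (h : ThirdAngleData A B C d u₁ v₁ u₂ v₂ u₃ v₃) :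
    0 < (v₂ - u₂) / 2 + (v₃ - u₃) / 2 := by
  have h1 := mul_pos h.u₁_pos h.u₂_pos
  have h2 := mul_pos h.u₁_pos h.u₃_pos
  have hv : v₁ < 1 := by
    have := mul_pos h.u₁_pos h.v₁_pos
    nlinarith [h.norm₁, h.u₁_pos]
  have h3 := mul_pos h.v₂_pos (sub_pos.mpr hv)
  have h4 := mul_pos h.v₃_pos (sub_pos.mpr hv)
  linarith [h.u₂_eq, h.u₃_eq]

theorem side_le (h : ThirdAngleData A B C d u₁ v₁ u₂ v₂ u₃ v₃) :
    u₂ * v₂ * (u₂ + v₂) ≤ u₁ * v₁ * (u₁ + v₁) + u₃ * v₃ * (u₃ + v₃) := by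
  have := dist_triangle C B A
  rw [dist_comm C B, dist_comm B A, h.dist_BC, h.dist_CA, h.dist_AB, ← mul_add] at this
  exact le_of_mul_le_mul_left this h.d_pos

theorem sum_vertex_pos (h : ThirdAngleData A B C d u₁ v₁ u₂ v₂ u₃ v₃) :
    0 < u₁ * v₁ * (u₁ + v₁) + u₂ * v₂ * (u₂ + v₂) * ((v₃ - u₃) / 2) +
      u₃ * v₃ * (u₃ + v₃) * ((v₂ - u₂) / 2) := by
  have hs := h.sigma_add_pos
  have hb := h.side_le
  have hc := h.swap.side_le
  have h2 := (abs_lt.mp h.rotate.abs_sigma_lt).2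
  have h3 := (abs_lt.mp h.swap.rotate.abs_sigma_lt).2
  obtain ⟨-, -, p1, q1, p2, q2, p3, q3, -⟩ := h
  have ha : 0 < u₁ * v₁ * (u₁ + v₁) := by positivity
  have hb0 : 0 < u₂ * v₂ * (u₂ + v₂) := by positivity
  have hc0 : 0 < u₃ * v₃ * (u₃ + v₃) := by positivity
  generalize (v₂ - u₂) / 2 = s at *
  generalize (v₃ - u₃) / 2 = t at *
  generalize u₁ * v₁ * (u₁ + v₁) = a at *
  generalize u₂ * v₂ * (u₂ + v₂) = b at *
  generalize u₃ * v₃ * (u₃ + v₃) = c at *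
  rcases lt_or_ge t 0 with ht | ht
  -- Write the sum as a + b(s + t) + (c - b)s; the triangle inequality bounds the last term below by
  -- -as, and s < 1/2.
  · have hs0 : 0 < s := by linarith
    nlinarith [mul_pos hb0 hs, mul_nonneg (sub_nonneg.mpr hb) hs0.le]
  · rcases lt_or_ge s 0 with hs0 | hs0
    · have ht0 : 0 < t := by linarith
      nlinarith [mul_pos hc0 hs, mul_nonneg (sub_nonneg.mpr hc) ht0.le]
    · positivity

/-- The projection formula a = b cos 3α₃ + c cos 3α₂, with cos 3α = σ(3 - 4σ²) = σ(2 + 3uv). -/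
theorem side_projection (h : ThirdAngleData A B C d u₁ v₁ u₂ v₂ u₃ v₃) :
    u₁ * v₁ * (u₁ + v₁) =
      u₂ * v₂ * (u₂ + v₂) * ((v₃ - u₃) / 2) * (2 + 3 * (u₃ * v₃)) +
      u₃ * v₃ * (u₃ + v₃) * ((v₂ - u₂) / 2) * (2 + 3 * (u₂ * v₂)) := by
  have e₂ := h.norm₂
  have e₃ := h.norm₃
  rw [h.u₁_eq, h.v₁_eq]
  linear_combination (u₂ * v₂ * (u₂ + v₂)) * (v₃ - u₃) * e₃ +
    (u₃ * v₃ * (u₃ + v₃)) * (v₂ - u₂) * e₂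

theorem sum_perspector_pos_of_pos (h : ThirdAngleData A B C d u₁ v₁ u₂ v₂ u₃ v₃)
    (h2 : 0 < (v₂ - u₂) / 2) (h3 : 0 < (v₃ - u₃) / 2) :
    0 < u₁ * v₁ * (u₁ + v₁) * ((v₂ - u₂) / 2) * ((v₃ - u₃) / 2) +
      u₂ * v₂ * (u₂ + v₂) * ((v₃ - u₃) / 2) * ((v₁ - u₁) / 2) +
      u₃ * v₃ * (u₃ + v₃) * ((v₁ - u₁) / 2) * ((v₂ - u₂) / 2) := by
  -- The term -2σ₂σ₃ cancels the 2 in 2 + 3uv from `side_projection`, leaving only positive terms.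
  have e : (v₁ - u₁) / 2 = 3 / 2 * (u₂ * u₃) - 2 * ((v₂ - u₂) / 2) * ((v₃ - u₃) / 2) := by
    linear_combination 1 / 2 * h.v₁_eq - 1 / 2 * h.u₁_eq
  rw [h.side_projection, e]
  obtain ⟨-, -, -, -, p2, q2, p3, q3, -⟩ := h
  generalize (v₂ - u₂) / 2 = s at *
  generalize (v₃ - u₃) / 2 = t at *
  have : 0 < u₂ * v₂ * (u₂ + v₂) * t * (3 / 2 * (u₂ * u₃) + 3 * (u₃ * v₃) * s * t) +
    u₃ * v₃ * (u₃ + v₃) * s * (3 / 2 * (u₂ * u₃) + 3 * (u₂ * v₂) * s * t) := by positivity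
  linarith

/-- The sum is cyclically symmetric and some two of the σᵢ are positive. -/
theorem sum_perspector_pos (h : ThirdAngleData A B C d u₁ v₁ u₂ v₂ u₃ v₃) :
    0 < u₁ * v₁ * (u₁ + v₁) * ((v₂ - u₂) / 2) * ((v₃ - u₃) / 2) +
      u₂ * v₂ * (u₂ + v₂) * ((v₃ - u₃) / 2) * ((v₁ - u₁) / 2) +
      u₃ * v₃ * (u₃ + v₃) * ((v₁ - u₁) / 2) * ((v₂ - u₂) / 2) := by
  have s₁ := h.sigma_add_pos
  have s₂ := h.rotate.sigma_add_pos
  have s₃ := h.rotate.rotate.sigma_add_pos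
  rcases lt_or_ge 0 ((v₂ - u₂) / 2) with h2 | h2
  · rcases lt_or_ge 0 ((v₃ - u₃) / 2) with h3 | h3
    · exact h.sum_perspector_pos_of_pos h2 h3
    · linarith [h.rotate.rotate.sum_perspector_pos_of_pos (by linarith) h2]
  · linarith [h.rotate.sum_perspector_pos_of_pos (by linarith) (by linarith)]

end ThirdAngleData

/-- The Gram determinant of three numbers of absolute value less than one half is positive. -/
theorem gram_pos {x y z : ℝ} (hx : |x| < 1 / 2) (hy : |y| < 1 / 2) (hz : |z| < 1 / 2) :
    0 < 1 + 2 * x * y * z - x ^ 2 - y ^ 2 - z ^ 2 := by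
  have hx2 : x ^ 2 < 1 / 4 := by rw [← sq_abs]; nlinarith [abs_nonneg x]
  have hy2 : y ^ 2 < 1 / 4 := by rw [← sq_abs]; nlinarith [abs_nonneg y]
  -- The determinant equals (1 - x²)(1 - y²) - (z - xy)², and the product exceeds 9/16.
  have h : |z - x * y| < 3 / 4 := by
    calc |z - x * y| ≤ |z| + |x| * |y| := by rw [← abs_mul]; exact abs_sub z (x * y)
      _ < 3 / 4 := by nlinarith [abs_nonneg x, abs_nonneg y]
  have h2 : (z - x * y) ^ 2 < 9 / 16 := by rw [← sq_abs]; nlinarith [abs_nonneg (z - x * y)]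
  nlinarith

/-! ### Radical lines, incidence, and the perspective triangle. -/

/-- The radical line of two circles is the line through two of its points. -/
theorem isRadicalLineOf_line {s t : Set Plane} {ω₁ ω₂ : Sphere Plane}
    (hs : IsCircleThrough ω₁ s) (ht : IsCircleThrough ω₂ t) {X Y Z P : Plane}
    (hi : AffineIndependent ℝ ![X, Y, Z]) (hY : ω₁.power Y - ω₂.power Y = 0)
    (hZ : ω₁.power Z - ω₂.power Z = 0) (hP : ω₁.power P - ω₂.power P ≠ 0) :
    IsRadicalLineOf line[ℝ, Y, Z] s t := by
  -- The difference of powers is affine and vanishes at Y and Z; the point P only ensures that it is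
  -- not identically zero.
  have key : ∀ x y z : ℝ, x + y + z = 1 → ω₁.power (x • X + y • Y + z • Z) -
      ω₂.power (x • X + y • Y + z • Z) = x * (ω₁.power X - ω₂.power X) := by
    intro x y z h
    rw [power_barycentric _ _ _ _ h, power_barycentric _ _ _ _ h]
    linear_combination y * hY + z * hZ
  have hX : ω₁.power X - ω₂.power X ≠ 0 := by
    intro h0
    obtain ⟨x, y, z, h, rfl⟩ := exists_barycentric hi P
    rw [key x y z h, h0, mul_zero] at hP
    exact hP rfl
  have hne : Y ≠ Z := fun h => by simpa using hi.injective.ne (show (1 : Fin 3) ≠ 2 by decide) h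
  refine ⟨?_, ω₁, ω₂, hs, ht, ?_⟩
  · rw [direction_affineSpan, vectorSpan_pair_rev]
    exact finrank_span_singleton (sub_ne_zero.mpr hne.symm)
  · ext Q
    obtain ⟨x, y, z, h, rfl⟩ := exists_barycentric hi Q
    rw [radicalLine, Set.mem_ofPred_eq, ← sub_eq_zero, key x y z h, mul_eq_zero, or_iff_left hX,
      SetLike.mem_coe]
    constructor
    · intro hm
      rw [mem_affineSpan_pair_iff_exists_lineMap_eq] at hm
      obtain ⟨r, hr⟩ := hm
      rw [AffineMap.lineMap_apply_module] at hr
      have := eq_zero_of_barycentric_eq_zero hi (x := x) (y := y - (1 - r)) (z := z - r)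
        (by linarith) (by rw [← sub_eq_zero.mpr hr.symm]; module)
      exact this.1
    · rintro rfl
      rw [mem_affineSpan_pair_iff_exists_lineMap_eq]
      refine ⟨z, ?_⟩
      rw [AffineMap.lineMap_apply_module]
      obtain rfl : y = 1 - z := by linarith
      module

theorem mem_line_of_barycentric {A B C X P : Plane} (t : ℝ) {x y z x' y' z' : ℝ}
    (hX : X = x • A + y • B + z • C) (hP : P = x' • A + y' • B + z' • C)
    (hx : x' = 1 - t + t * x) (hy : y' = t * y) (hz : z' = t * z) : P ∈ line[ℝ, A, X] := by
  have : P = AffineMap.lineMap A X t := by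
    rw [AffineMap.lineMap_apply_module, hX, hP, hx, hy, hz]
    module
  rw [this]
  exact AffineMap.lineMap_mem_affineSpan_pair t A X

theorem ne_of_barycentric {A B C X : Plane} (hi : AffineIndependent ℝ ![A, B, C]) {x y z : ℝ}
    (hX : X = x • A + y • B + z • C) (hs : x + y + z = 1) (hne : y ≠ 0 ∨ z ≠ 0) : A ≠ X := by
  intro h
  obtain ⟨-, h2, h3⟩ := eq_zero_of_barycentric_eq_zero hi (x := x - 1) (y := y) (z := z)
    (by linarith) (by rw [← sub_eq_zero.mpr (hX.symm.trans h.symm)]; module)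
  exact hne.elim (· h2) (· h3)

theorem mainTheorem12
    (A B C : Plane) (hABC : AffineIndependent ℝ ![A, B, C])
    (A_A B_A C_A A_B B_B C_B A_C B_C C_C : Plane)
    (hA : IsExternalMorleyTriangle A B C A_A B_A C_A)
    (hB : IsExternalMorleyTriangle B C A B_B C_B A_B)
    (hC : IsExternalMorleyTriangle C A B C_C A_C B_C) :
    ∃ l_A l_B l_C : AffineSubspace ℝ Plane,
      IsRadicalLineOf l_A {A_A, A_B, A_C} {C_A, B_A, B_B, C_C} ∧
      IsRadicalLineOf l_B {B_B, B_C, B_A} {A_B, C_B, C_C, A_A} ∧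
      IsRadicalLineOf l_C {C_C, C_A, C_B} {B_C, A_C, A_A, B_B} ∧
      ∃ X Y Z : Plane, FormTriangle l_A l_B l_C X Y Z ∧ ArePerspective A B C X Y Z := by
  obtain ⟨d, u₁, v₁, u₂, v₂, u₃, v₃, h⟩ := exists_thirdAngleData hABC
  obtain ⟨ω₁, ω₂, hω₁, hω₂, k₁, hk₁, f₁⟩ := h.exists_circles hA hB hC
  obtain ⟨ω₃, ω₄, hω₃, hω₄, k₂, hk₂, f₂⟩ := h.rotate.exists_circles hB hC hA
  obtain ⟨ω₅, ω₆, hω₅, hω₆, k₃, hk₃, f₃⟩ := h.rotate.rotate.exists_circles hC hA hB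
  have g₁ := h.abs_sigma_lt
  have g₂ := h.rotate.abs_sigma_lt
  have g₃ := h.rotate.rotate.abs_sigma_lt
  have t₁ := h.sigma_add_pos
  have t₂ := h.rotate.sigma_add_pos
  have t₃ := h.rotate.rotate.sigma_add_pos
  have hp := h.sum_perspector_pos
  have s₁ := h.sum_vertex_pos
  have s₂ := h.rotate.sum_vertex_pos
  have s₃ := h.rotate.rotate.sum_vertex_pos
  have ha : 0 < u₁ * v₁ * (u₁ + v₁) :=
    mul_pos (mul_pos h.u₁_pos h.v₁_pos) (add_pos h.u₁_pos h.v₁_pos)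
  have hb : 0 < u₂ * v₂ * (u₂ + v₂) :=
    mul_pos (mul_pos h.u₂_pos h.v₂_pos) (add_pos h.u₂_pos h.v₂_pos)
  have hc : 0 < u₃ * v₃ * (u₃ + v₃) :=
    mul_pos (mul_pos h.u₃_pos h.v₃_pos) (add_pos h.u₃_pos h.v₃_pos)
  have hBCA := h.rotate.indep
  have hCAB := h.rotate.rotate.indep
  clear h
  generalize (v₁ - u₁) / 2 = x at *
  generalize (v₂ - u₂) / 2 = y at *
  generalize (v₃ - u₃) / 2 = z at *
  generalize u₁ * v₁ * (u₁ + v₁) = a at *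
  generalize u₂ * v₂ * (u₂ + v₂) = b at *
  generalize u₃ * v₃ * (u₃ + v₃) = c at *
  obtain ⟨S₁, hS₁⟩ : ∃ S, S = a + b * z + c * y := ⟨_, rfl⟩
  obtain ⟨S₂, hS₂⟩ : ∃ S, S = b + c * x + a * z := ⟨_, rfl⟩
  obtain ⟨S₃, hS₃⟩ : ∃ S, S = c + a * y + b * x := ⟨_, rfl⟩
  obtain ⟨p, hpp⟩ : ∃ S, S = a * y * z + b * z * x + c * x * y := ⟨_, rfl⟩
  rw [← hS₁] at s₁
  rw [← hS₂] at s₂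
  rw [← hS₃] at s₃
  rw [← hpp] at hp
  have hX1 : a / S₁ + b * z / S₁ + c * y / S₁ = 1 := by field_simp; linarith
  have hY1 : a * z / S₂ + b / S₂ + c * x / S₂ = 1 := by field_simp; linarith
  have hZ1 : a * y / S₃ + b * x / S₃ + c / S₃ = 1 := by field_simp; linarith
  have hP1 : a * y * z / p + b * z * x / p + c * x * y / p = 1 := by field_simp; linarith
  -- From here x, y, z are the σᵢ; the three points are the rows of G, weighted by the sides and
  -- normalized.
  obtain ⟨X, hX⟩ : ∃ X, X = (a / S₁) • A + (b * z / S₁) • B + (c * y / S₁) • C := ⟨_, rfl⟩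
  obtain ⟨Y, hY⟩ : ∃ Y, Y = (a * z / S₂) • A + (b / S₂) • B + (c * x / S₂) • C := ⟨_, rfl⟩
  obtain ⟨Z, hZ⟩ : ∃ Z, Z = (a * y / S₃) • A + (b * x / S₃) • B + (c / S₃) • C := ⟨_, rfl⟩
  have hX₂ : X = (b * z / S₁) • B + (c * y / S₁) • C + (a / S₁) • A := by rw [hX]; abel
  have hX₃ : X = (c * y / S₁) • C + (a / S₁) • A + (b * z / S₁) • B := by rw [hX]; abel
  have hY₂ : Y = (b / S₂) • B + (c * x / S₂) • C + (a * z / S₂) • A := by rw [hY]; abel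
  have hY₃ : Y = (c * x / S₂) • C + (a * z / S₂) • A + (b / S₂) • B := by rw [hY]; abel
  have hZ₂ : Z = (b * x / S₃) • B + (c / S₃) • C + (a * y / S₃) • A := by rw [hZ]; abel
  have hZ₃ : Z = (c / S₃) • C + (a * y / S₃) • A + (b * x / S₃) • B := by rw [hZ]; abel
  have hXYZ : AffineIndependent ℝ ![X, Y, Z] := by
    rw [hX, hY, hZ]
    refine affineIndependent_of_barycentric hABC hX1 hY1 hZ1 ?_
    have hG := gram_pos g₁ g₂ g₃
    have : 0 < a * b * c * (1 + 2 * x * y * z - x ^ 2 - y ^ 2 - z ^ 2) / (S₁ * S₂ * S₃) := by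
      positivity
    refine (this.trans_eq ?_).ne'
    field_simp
    ring
  have hYZX : AffineIndependent ℝ ![Y, Z, X] := by
    rw [affineIndependent_iff_not_collinear_set] at hXYZ ⊢
    rwa [Set.insert_comm X Y, Set.pair_comm X Z] at hXYZ
  have hZXY : AffineIndependent ℝ ![Z, X, Y] := by
    rw [affineIndependent_iff_not_collinear_set] at hYZX ⊢
    rwa [Set.insert_comm Y Z, Set.pair_comm Y X] at hYZX
  have sq_lt : ∀ w : ℝ, |w| < 1 / 2 → 1 - w ^ 2 ≠ 0 := fun w hw => by
    rw [← sq_abs]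
    nlinarith [abs_nonneg w]
  refine ⟨line[ℝ, Y, Z], line[ℝ, Z, X], line[ℝ, X, Y],
    isRadicalLineOf_line (P := A) hω₁ hω₂ hXYZ ?_ ?_ ?_,
    isRadicalLineOf_line (P := B) hω₃ hω₄ hYZX ?_ ?_ ?_,
    isRadicalLineOf_line (P := C) hω₅ hω₆ hZXY ?_ ?_ ?_, X, Y, Z, ⟨hXYZ, rfl, rfl, rfl⟩,
    ne_of_barycentric hABC hX hX1 ?_, ne_of_barycentric hBCA hY₂ (by linarith) ?_,
    ne_of_barycentric hCAB hZ₃ (by linarith) ?_,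
    (a * y * z / p) • A + (b * z * x / p) • B + (c * x * y / p) • C, ?_, ?_, ?_⟩
  · rw [hY, f₁ _ _ _ hY1]
    field_simp
    ring
  · rw [hZ, f₁ _ _ _ hZ1]
    field_simp
    ring
  · have := f₁ 1 0 0 (by norm_num)
    simp only [one_smul, zero_smul, add_zero, one_mul, zero_mul] at this
    rw [this]
    exact mul_ne_zero hk₁ (mul_ne_zero (mul_pos hb hc).ne' (sq_lt x g₁))
  · rw [hZ₂, f₂ _ _ _ (by linarith)]
    field_simp
    ring
  · rw [hX₂, f₂ _ _ _ (by linarith)]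
    field_simp
    ring
  · have := f₂ 1 0 0 (by norm_num)
    simp only [one_smul, zero_smul, add_zero, one_mul, zero_mul] at this
    rw [this]
    exact mul_ne_zero hk₂ (mul_ne_zero (mul_pos hc ha).ne' (sq_lt y g₂))
  · rw [hX₃, f₃ _ _ _ (by linarith)]
    field_simp
    ring
  · rw [hY₃, f₃ _ _ _ (by linarith)]
    field_simp
    ring
  · have := f₃ 1 0 0 (by norm_num)
    simp only [one_smul, zero_smul, add_zero, one_mul, zero_mul] at this
    rw [this]
    exact mul_ne_zero hk₃ (mul_ne_zero (mul_pos ha hb).ne' (sq_lt z g₃))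
  -- X = A would force σ₂ = σ₃ = 0, against σ₂ + σ₃ > 0.
  · by_contra! hcon
    have h1 : z = 0 := by simpa [hb.ne', s₁.ne'] using hcon.1
    have h2 : y = 0 := by simpa [hc.ne', s₁.ne'] using hcon.2
    linarith
  · by_contra! hcon
    have h1 : x = 0 := by simpa [hc.ne', s₂.ne'] using hcon.1
    have h2 : z = 0 := by simpa [ha.ne', s₂.ne'] using hcon.2
    linarith
  · by_contra! hcon
    have h1 : y = 0 := by simpa [ha.ne', s₃.ne'] using hcon.1
    have h2 : x = 0 := by simpa [hb.ne', s₃.ne'] using hcon.2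
    linarith
  -- The parameter is read off from the B-coordinate: t · bz/S₁ = bzx/p.
  · refine mem_line_of_barycentric (x * S₁ / p) hX rfl ?_ ?_ ?_
    · field_simp
      rw [hpp, hS₁]
      ring
    · field_simp
    · field_simp
  · refine mem_line_of_barycentric (y * S₂ / p) hY₂ (y' := c * x * y / p) (z' := a * y * z / p)
      (x' := b * z * x / p) (by abel) ?_ ?_ ?_
    · field_simp
      rw [hpp, hS₂]
      ring
    · field_simp
    · field_simp
  · refine mem_line_of_barycentric (z * S₃ / p) hZ₃ (y' := a * y * z / p) (z' := b * z * x / p)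
      (x' := c * x * y / p) (by abel) ?_ ?_ ?_
    · field_simp
      rw [hpp, hS₃]
      ring
    · field_simp
    · field_simp
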